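/- **Theorem.** Let $N\ge 2$ be an integer, $r_a>0$, $h\ge 0$, $\alpha>2$, $\beta>0$, $m>0$ real, and $m_0\ge 1$ an integer. Let $N$ transmitters be placed independently and uniformly in the horizontal disk of radius $r_a$ centred at $(0,0,h)$, and let a receiver be located on the ground plane at a point at distance $x_0$ from the origin, $0\le x_0\le r_a$. Let $W_{(1)}\le\dots\le W_{(N)}$ be the ordered distances from the receiver to the transmitters, $R=W_{(1)}$ and $U_i=W_{(i+1)}$ for $1\le i\le N-1$. Let $G_0,G_1,\dots,G_{N-1}$ be independent random variables, independent of the locations, such that $G_0$ is gamma distributed with shape $m_0$ and rate $m_0$, and each $G_i$, $i\ge 1$, is gamma distributed with shape $m$ and rate $m$ (Nakagami fading). Put $$\mathtt{SIR}=\frac{G_0R^{-\alpha}}{\sum_{i=1}^{N-1}G_iU_i^{-\alpha}} ,\qquad \mathtt{P_c}=\mathbb P(\mathtt{SIR}>\beta).$$ Let $d=\sqrt{r_a^2+h^2}$, $w_m=\sqrt{(r_a-x_0)^2+h^2}$, $w_p=\sqrt{(r_a+x_0)^2+h^2}$, $$\theta^*(w)=\arccos\frac{w^2+x_0^2-d^2}{2x_0\sqrt{w^2-h^2}},\qquad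 \phi^*(w)=\arccos\frac{x_0^2+d^2-w^2}{2x_0r_a},$$ $$F_1(w)=\frac{w^2-h^2}{r_a^2},\qquad F_2(w)=\frac{w^2-h^2}{\pi r_a^2}\Big(\theta^*-\tfrac12\sin2\theta^*\Big)+\frac1\pi\Big(\phi^*-\tfrac12\sin2\phi^*\Big),$$ $$f_1(w)=\frac{2w}{r_a^2},\qquad f_2(w)=\frac{2w}{\pi r_a^2}\,\theta^*(w),$$ $$\mathcal A(s,r)=\bigg[\int_r^{w_m}\Big(1+\frac{su^{-\alpha}}m\Big)^{-m}\frac{f_1(u)}{1-F_1(r)}\,du+\int_{w_m}^{w_p}\Big(1+\frac{su^{-\alpha}}m\Big)^{-m}\frac{f_2(u)}{1-F_1(r)}\,du\bigg]^{N-1},$$ $$\mathcal B(s,r)=\bigg[\int_r^{w_p}\Big(1+\frac{su^{-\alpha}}m\Big)^{-m}\frac{f_2(u)}{1-F_2(r)}\,du\bigg]^{N-1}.$$ Then $\mathcal A(\cdot,r)$ for $h<r<w_m$, and $\mathcal B(\cdot,r)$ for $w_m<r<w_p$, are $m_0$ times continuously differentiable near $s=m_0\beta r^\alpha$, the two integrands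 below are integrable, and $$\begin{aligned}\mathtt{P_c}={}&\int_h^{w_m}\bigg(\sum_{k=0}^{m_0-1}\frac{(-m_0\beta r^\alpha)^k}{k!}\Big[\frac{\partial^k}{\partial s^k}\mathcal A(s,r)\Big]_{s=m_0\beta r^\alpha}\bigg)N\big(1-F_1(r)\big)^{N-1}f_1(r)\,dr\\&+\int_{w_m}^{w_p}\bigg(\sum_{k=0}^{m_0-1}\frac{(-m_0\beta r^\alpha)^k}{k!}\Big[\frac{\partial^k}{\partial s^k}\mathcal B(s,r)\Big]_{s=m_0\beta r^\alpha}\bigg)N\big(1-F_2(r)\big)^{N-1}f_2(r)\,dr .\end{aligned}$$ (If $x_0=0$, then $w_m=w_p$, and the integrals over $[w_m,w_p]$ are zero.) -/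

import Mathlib

open MeasureTheory ProbabilityTheory

noncomputable section

namespace UAV

/-- The point of `ℝ³` at height `h` above the point `y` of the ground plane. -/
def atHeight (h : ℝ) (y : EuclideanSpace ℝ (Fin 2)) : EuclideanSpace ℝ (Fin 3) :=
  !₂[y 0, y 1, h]

/-- Distances `W_i` from a receiver on the ground at `x` to transmitters at height `h` above the
points `y i`. -/
def linkDist {N : ℕ} (h : ℝ) (x : EuclideanSpace ℝ (Fin 2))
    (y : Fin N → EuclideanSpace ℝ (Fin 2)) (i : Fin N) : ℝ :=
  dist (atHeight 0 x) (atHeight h (y i))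

/-- The distances in increasing order, counted from zero: `ordered W i` is the `(i+1)`-st smallest
of the numbers `W 0, …, W (N-1)`. -/
def ordered {N : ℕ} (W : Fin N → ℝ) (i : Fin N) : ℝ :=
  W (Tuple.sort W i)

/-- Interference power: the gain `g i`, `1 ≤ i ≤ N-1`, belongs to the `i`-th closest of the
`N-1` transmitters other than the serving (closest) one. -/
def interference {N : ℕ} [NeZero N] (α : ℝ) (W g : Fin N → ℝ) : ℝ :=
  ∑ i ∈ Finset.univ.erase (0 : Fin N), g i * ordered W i ^ (-α)

/-- Signal-to-interference ratio when the closest transmitter serves, with gain `g 0`. -/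
def SIR {N : ℕ} [NeZero N] (α : ℝ) (W g : Fin N → ℝ) : ℝ :=
  g 0 * ordered W 0 ^ (-α) / interference α W g

section Distances

variable (ra h x₀ : ℝ)

/-- `w_m`. -/
def wMinus : ℝ := √((ra - x₀) ^ 2 + h ^ 2)

/-- `w_p`. -/
def wPlus : ℝ := √((ra + x₀) ^ 2 + h ^ 2)

/-- `d`, the distance from the origin to the boundary of the disk of transmitters. -/
def edgeDist : ℝ := √(ra ^ 2 + h ^ 2)

/-- `θ*`. -/
def thetaStar (w : ℝ) : ℝ :=
  Real.arccos ((w ^ 2 + x₀ ^ 2 - edgeDist ra h ^ 2) / (2 * x₀ * √(w ^ 2 - h ^ 2)))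

/-- `φ*`. -/
def phiStar (w : ℝ) : ℝ :=
  Real.arccos ((x₀ ^ 2 + edgeDist ra h ^ 2 - w ^ 2) / (2 * x₀ * ra))

/-- `F_{W,1}`, the distribution function of a link distance on `[h, w_m]`. -/
def cdf₁ (w : ℝ) : ℝ := (w ^ 2 - h ^ 2) / ra ^ 2

/-- `F_{W,2}`, the distribution function of a link distance on `(w_m, w_p]`. -/
def cdf₂ (w : ℝ) : ℝ :=
  (w ^ 2 - h ^ 2) / (Real.pi * ra ^ 2) *
      (thetaStar ra h x₀ w - 1 / 2 * Real.sin (2 * thetaStar ra h x₀ w)) +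
    1 / Real.pi * (phiStar ra h x₀ w - 1 / 2 * Real.sin (2 * phiStar ra h x₀ w))

/-- `f_{W,1}`. -/
def pdf₁ (w : ℝ) : ℝ := 2 * w / ra ^ 2

/-- `f_{W,2}`. -/
def pdf₂ (w : ℝ) : ℝ :=
  2 * w / (Real.pi * ra ^ 2) *
    Real.arccos ((w ^ 2 + x₀ ^ 2 - edgeDist ra h ^ 2) / (2 * x₀ * √(w ^ 2 - h ^ 2)))

/-- `𝒜(s, r, x₀)`. -/
def laplaceA (N : ℕ) (α m s r : ℝ) : ℝ :=
  ((∫ u in r..wMinus ra h x₀, (1 + s * u ^ (-α) / m) ^ (-m) * (pdf₁ ra u / (1 - cdf₁ ra h r))) +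
    ∫ u in wMinus ra h x₀..wPlus ra h x₀,
      (1 + s * u ^ (-α) / m) ^ (-m) * (pdf₂ ra h x₀ u / (1 - cdf₁ ra h r))) ^ (N - 1)

/-- `ℬ(s, r, x₀)`. -/
def laplaceB (N : ℕ) (α m s r : ℝ) : ℝ :=
  (∫ u in r..wPlus ra h x₀,
    (1 + s * u ^ (-α) / m) ^ (-m) * (pdf₂ ra h x₀ u / (1 - cdf₂ ra h x₀ r))) ^ (N - 1)

/-- The integrand of the coverage probability for `h ≤ r ≤ w_m`. -/
def coverageA (N m₀ : ℕ) (α m β r : ℝ) : ℝ :=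
  (∑ k ∈ Finset.range m₀, (-(m₀ * β * r ^ α)) ^ k / (k.factorial : ℝ) *
      iteratedDeriv k (fun s => laplaceA ra h x₀ N α m s r) (m₀ * β * r ^ α)) *
    (N * (1 - cdf₁ ra h r) ^ (N - 1) * pdf₁ ra r)

/-- The integrand of the coverage probability for `w_m ≤ r ≤ w_p`. -/
def coverageB (N m₀ : ℕ) (α m β r : ℝ) : ℝ :=
  (∑ k ∈ Finset.range m₀, (-(m₀ * β * r ^ α)) ^ k / (k.factorial : ℝ) *
      iteratedDeriv k (fun s => laplaceB ra h x₀ N α m s r) (m₀ * β * r ^ α)) *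
    (N * (1 - cdf₂ ra h x₀ r) ^ (N - 1) * pdf₂ ra h x₀ r)

end Distances

end UAV

end

noncomputable section

namespace UAV

/-! ### Gamma distributions -/

section Gamma

open Real Filter Topology

/-! The link distances are i.i.d. with an atomless law `μ` (`linkLaw`), so almost surely exactly one
transmitter is closest, and by exchangeability coverage has `N` times the probability of coverage
with transmitter `0` closest. On that event the ranking fixes index `0` and permutes only i.i.d.
interferer gains, so it can be undone. This gives `N ∫ T(r) dμ(r)` (`measure_SIR_gt`), where `T(r)`
(`condCoverage`) also carries the mass of the event that the others lie beyond `r`.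

For fixed `r`, put `s = m₀ β r ^ α` and let `I` be the interference. A gamma tail of integer shape
is a finite Poisson sum, so `T(r)` is the sum over `k < m₀` of `s ^ k / k!` times the expectation of
`I ^ k exp (-s I)`. These expectations are derivatives of the moment generating function of `I` at
`-s` (`toReal_condCoverage`), which independence factors into a power of a one-link integral
(`mgf_interf`). Its normalised form is `laplaceA` or `laplaceB`, and the normalisation cancels
against `(1 - F) ^ (N - 1)` (`sum_iteratedDeriv_laplace`).

The density of `μ` comes from polar coordinates around the receiver (`linkLaw_eq`). The closed form
of the second distribution function, a lens area, is confirmed by differentiation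
(`hasDerivAt_cdf₂`). Smoothness in `s` is analyticity of the moment generating function;
integrability follows from `T ≤ 1`. -/

lemma integrable_gammaPDFReal {a r : ℝ} (ha : 0 < a) (hr : 0 < r) :
    Integrable (gammaPDFReal a r) := by
  refine ⟨(measurable_gammaPDFReal a r).aestronglyMeasurable, ?_⟩
  rw [hasFiniteIntegral_iff_ofReal (ae_of_all _ (gammaPDFReal_nonneg ha hr))]
  exact (lintegral_gammaPDF_eq_one ha hr).trans_lt ENNReal.one_lt_top

lemma integral_gammaMeasure {a r : ℝ} (ha : 0 < a) (hr : 0 < r) (f : ℝ → ℝ) :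
    ∫ x, f x ∂gammaMeasure a r = ∫ x, gammaPDFReal a r x * f x := by
  rw [gammaMeasure]
  unfold gammaPDF
  rw [integral_withDensity_eq_integral_toReal_smul
    (measurable_gammaPDFReal a r).ennreal_ofReal (by simp)]
  simp [ENNReal.toReal_ofReal (gammaPDFReal_nonneg ha hr _)]

lemma ae_pos_gammaMeasure (a r : ℝ) : ∀ᵐ x ∂gammaMeasure a r, 0 < x := by
  have h : gammaMeasure a r (Set.Iic 0) = 0 := by
    rw [gammaMeasure, withDensity_apply _ measurableSet_Iic,
      setLIntegral_congr Iio_ae_eq_Iic.symm]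
    exact lintegral_gammaPDF_of_nonpos le_rfl
  rw [ae_iff]
  simpa [Set.Iic_def] using h

/-- The Laplace transform of a gamma distribution. -/
lemma integral_exp_neg_mul_gammaMeasure {a r t : ℝ} (ha : 0 < a) (hr : 0 < r) (ht : 0 ≤ t) :
    ∫ x, exp (-(t * x)) ∂gammaMeasure a r = (1 + t / r) ^ (-a) := by
  have hint : Integrable (fun x => gammaPDFReal a r x * exp (-(t * x))) := by
    refine (integrable_gammaPDFReal ha hr).mono'
      ((measurable_gammaPDFReal a r).mul (by fun_prop)).aestronglyMeasurable
      (ae_of_all _ fun x => ?_)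
    rw [norm_mul, norm_of_nonneg (gammaPDFReal_nonneg ha hr x), norm_of_nonneg (exp_nonneg _)]
    rcases le_or_gt 0 x with hx | hx
    · exact mul_le_of_le_one_right (gammaPDFReal_nonneg ha hr x)
        (exp_le_one_iff.2 (by have := mul_nonneg ht hx; linarith))
    · simp [gammaPDFReal, not_le.2 hx]
  rw [integral_gammaMeasure ha hr, ← integral_add_compl (s := Set.Iic 0) measurableSet_Iic hint,
    Set.compl_Iic, setIntegral_congr_set Iio_ae_eq_Iic.symm, setIntegral_eq_zero_of_forall_eq_zero
      (fun x hx => by simp [gammaPDFReal, not_le.2 (Set.mem_Iio.1 hx)]), zero_add]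
  -- The exponential factor tilts the rate from `r` to `r + t`; what remains is an Euler integral.
  · have h1 : ∫ x in Set.Ioi 0, gammaPDFReal a r x * exp (-(t * x)) =
        ∫ x in Set.Ioi 0, r ^ a / Gamma a * (x ^ (a - 1) * exp (-((r + t) * x))) := by
      refine setIntegral_congr_fun measurableSet_Ioi fun x hx => ?_
      simp only [gammaPDFReal, (Set.mem_Ioi.1 hx).le, if_true]
      rw [show -((r + t) * x) = -(r * x) + -(t * x) by ring, exp_add]
      ring
    rw [h1, integral_const_mul, integral_rpow_mul_exp_neg_mul_Ioi ha (by positivity),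
      rpow_neg (by positivity), show 1 + t / r = (r + t) / r by field_simp,
      div_rpow (by positivity) hr.le, div_rpow one_pos.le (by positivity), one_rpow]
    have := (Gamma_pos_of_pos ha).ne'
    have := (rpow_pos_of_pos hr a).ne'
    field_simp

/-- The derivative telescopes: differentiating the power in term `k` cancels the exponential's
contribution from term `k - 1`. Only the top term survives, the gamma density of shape `n + 1` and
rate `c`. -/
lemma hasDerivAt_erlang_tail (c : ℝ) (n : ℕ) (t : ℝ) :
    HasDerivAt (fun t => -∑ k ∈ Finset.range (n + 1), (c * t) ^ k / (k.factorial : ℝ) *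
      exp (-(c * t))) (c * ((c * t) ^ n / (n.factorial : ℝ) * exp (-(c * t)))) t := by
  have hc : HasDerivAt (fun t => c * t) c t := by simpa using (hasDerivAt_id t).const_mul c
  have he : HasDerivAt (fun t => exp (-(c * t))) (exp (-(c * t)) * -c) t := hc.neg.exp
  induction n with
  | zero => simpa [mul_comm, Pi.neg_def] using he.neg
  | succ n ih =>
    have h2 := ih.sub (((hc.pow (n + 1)).div_const ((n + 1).factorial : ℝ)).mul he)
    refine (h2.congr_of_eventuallyEq (Eventually.of_forall fun s => ?_)).congr_deriv ?_
    · simp only [Finset.sum_range_succ _ (n + 1), Pi.sub_apply, Pi.mul_apply, Pi.pow_apply]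
      ring
    · have : ((n + 1).factorial : ℝ) = (n + 1) * n.factorial := by
        push_cast [Nat.factorial_succ]; ring
      rw [this]
      have := Nat.cast_ne_zero (R := ℝ).2 n.factorial_ne_zero
      simp only [Pi.pow_apply, Nat.add_sub_cancel]
      push_cast
      field_simp
      ring

/-- The tail of a gamma distribution whose shape is a positive integer. -/
lemma gammaMeasure_real_Ioi {n : ℕ} (hn : 1 ≤ n) {c t : ℝ} (hc : 0 < c) (ht : 0 ≤ t) :
    (gammaMeasure n c).real (Set.Ioi t) =
      ∑ k ∈ Finset.range n, (c * t) ^ k / (k.factorial : ℝ) * exp (-(c * t)) := by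
  obtain ⟨p, rfl⟩ : ∃ p, n = p + 1 := ⟨n - 1, by omega⟩
  have hp : (0 : ℝ) < (p + 1 : ℕ) := by positivity
  have hlim : Tendsto (fun t => -∑ k ∈ Finset.range (p + 1), (c * t) ^ k / (k.factorial : ℝ) *
      exp (-(c * t))) atTop (𝓝 0) := by
    have h1 : ∀ k ∈ Finset.range (p + 1), Tendsto (fun t => (c * t) ^ k / (k.factorial : ℝ) *
        exp (-(c * t))) atTop (𝓝 0) := fun k _ => by
      have := ((tendsto_pow_mul_exp_neg_atTop_nhds_zero k).comp
        (tendsto_id.const_mul_atTop hc)).div_const (k.factorial : ℝ)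
      simp only [zero_div] at this
      refine this.congr fun x => ?_
      simp only [Function.comp, id]
      ring
    simpa using (tendsto_finsetSum _ h1).neg
  have hint := integral_Ioi_of_hasDerivAt_of_nonneg' (a := t)
    (fun x _ => hasDerivAt_erlang_tail c p x)
    (fun x hx => by have : 0 < x := ht.trans_lt hx; positivity) hlim
  rw [zero_sub, neg_neg] at hint
  rw [← hint, measureReal_def, gammaMeasure, withDensity_apply _ measurableSet_Ioi]
  unfold gammaPDF
  rw [← ofReal_integral_eq_lintegral_ofReal (integrable_gammaPDFReal hp hc).integrableOn
    (ae_of_all _ (gammaPDFReal_nonneg hp hc)),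
    ENNReal.toReal_ofReal (setIntegral_nonneg measurableSet_Ioi
      fun x _ => gammaPDFReal_nonneg hp hc x)]
  refine setIntegral_congr_fun measurableSet_Ioi fun x hx => ?_
  have hx0 : 0 ≤ x := ht.trans hx.le
  simp only [gammaPDFReal, hx0, if_true]
  rw [rpow_natCast, Nat.cast_succ, add_sub_cancel_right, rpow_natCast, Gamma_nat_eq_factorial]
  ring

end Gamma

/-! ### The law of a link distance -/

section LinkLaw

open Real Set ENNReal

/-- The law of the distance from a receiver at `x` to a transmitter uniform in the disk. -/
def linkLaw (ra h : ℝ) (x : EuclideanSpace ℝ (Fin 2)) : Measure ℝ :=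
  (volume[|Metric.closedBall (0 : EuclideanSpace ℝ (Fin 2)) ra]).map
    fun y => dist (atHeight 0 x) (atHeight h y)

lemma dist_atHeight (h : ℝ) (x y : EuclideanSpace ℝ (Fin 2)) :
    dist (atHeight 0 x) (atHeight h y) = √(‖x - y‖ ^ 2 + h ^ 2) := by
  rw [EuclideanSpace.dist_eq, EuclideanSpace.norm_sq_eq]
  simp [atHeight, Fin.sum_univ_three, Fin.sum_univ_two, Real.dist_eq, sq_abs]

lemma measurable_dist_atHeight (h : ℝ) (x : EuclideanSpace ℝ (Fin 2)) :
    Measurable fun y => dist (atHeight 0 x) (atHeight h y) := by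
  simp_rw [dist_atHeight]
  fun_prop

/-- The length of the arc of the unit circle on which the first coordinate is at least `c`. -/
lemma volume_arc (c : ℝ) :
    volume (Ioo (-π) π ∩ {θ | c ≤ cos θ}) = ENNReal.ofReal (2 * arccos c) := by
  -- The set is squeezed between an open and a closed interval of equal length. Outside `[-1, 1]`
  -- the clamped values `0` and `π` of `arccos` still give the right length.
  have h1 : Ioo (-arccos c) (arccos c) ⊆ Ioo (-π) π ∩ {θ | c ≤ cos θ} := by
    rintro θ ⟨h1, h2⟩
    have hπ := arccos_le_pi c
    refine ⟨⟨by linarith, by linarith⟩, ?_⟩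
    have habs : |θ| < arccos c := abs_lt.2 ⟨h1, h2⟩
    have hc1 : c ≤ 1 := by
      by_contra! hc
      rw [arccos_eq_zero.2 hc.le] at habs
      exact absurd habs (abs_nonneg θ).not_gt
    have hc : c ≤ cos (arccos c) := by
      rcases le_total (-1) c with h | h
      · exact (cos_arccos h hc1).ge
      · rw [arccos_of_le_neg_one h, cos_pi]; exact h
    rw [mem_ofPred_eq, ← cos_abs]
    exact hc.trans (cos_le_cos_of_nonneg_of_le_pi (abs_nonneg θ) hπ habs.le)
  have h2 : Ioo (-π) π ∩ {θ | c ≤ cos θ} ⊆ Icc (-arccos c) (arccos c) := by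
    rintro θ ⟨hθ, h⟩
    rw [mem_ofPred_eq, ← cos_abs] at h
    rw [mem_Icc, ← abs_le]
    by_contra! hlt
    have hπ : |θ| < π := abs_lt.2 hθ
    have hc : -1 ≤ c := by
      by_contra! hc
      rw [arccos_of_le_neg_one hc.le] at hlt
      exact absurd hlt hπ.not_gt
    have := cos_lt_cos_of_nonneg_of_le_pi (arccos_nonneg c) hπ.le hlt
    rw [cos_arccos hc (h.trans (cos_le_one _))] at this
    exact absurd this h.not_gt
  refine le_antisymm ?_ ?_
  · refine (measure_mono h2).trans_eq ?_
    rw [volume_Icc]; ring_nf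
  · refine Eq.trans_le ?_ (measure_mono h1)
    rw [volume_Ioo]; ring_nf

/-- Rotating `x` onto the nonnegative real axis lets the complex polar angle be measured from the
direction of `x`. -/
lemma exists_linearIsometryEquiv_complex (x : EuclideanSpace ℝ (Fin 2)) :
    ∃ e : EuclideanSpace ℝ (Fin 2) ≃ₗᵢ[ℝ] ℂ, e x = (‖x‖ : ℂ) := by
  let e₀ := Complex.orthonormalBasisOneI.repr.symm
  refine ⟨e₀.trans (rotation (Circle.exp (-(e₀ x).arg))), ?_⟩
  have h := Complex.norm_mul_exp_arg_mul_I (e₀ x)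
  rw [e₀.norm_map] at h
  rw [LinearIsometryEquiv.trans_apply, rotation_apply, Circle.coe_exp]
  nth_rewrite 2 [← h]
  rw [mul_left_comm, ← Complex.exp_add]
  simp

/-- Polar coordinates around `x` in a disk centred at the origin. -/
lemma lintegral_disk_polar (ra : ℝ) (hra : 0 ≤ ra) (x : EuclideanSpace ℝ (Fin 2))
    {F : ℝ → ℝ≥0∞} (hF : Measurable F) :
    ∫⁻ y in Metric.closedBall (0 : EuclideanSpace ℝ (Fin 2)) ra, F ‖x - y‖ =
      ∫⁻ ρ in Ioi (0 : ℝ), ENNReal.ofReal ρ * F ρ * volume (Ioo (-π) π ∩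
        {θ | ρ ^ 2 + ‖x‖ ^ 2 - 2 * ρ * ‖x‖ * cos θ ≤ ra ^ 2}) := by
  obtain ⟨e, he⟩ := exists_linearIsometryEquiv_complex x
  -- Under `z = ‖x‖ - e y` the receiver becomes the origin and the disk is centred at `‖x‖`.
  let f : ℂ → ℝ≥0∞ := fun z =>
    (Metric.closedBall (‖x‖ : ℂ) ra).indicator (fun z => F ‖z‖) z
  have hf : Measurable f := (hF.comp measurable_norm).indicator measurableSet_closedBall
  have h1 : ∫⁻ y in Metric.closedBall (0 : EuclideanSpace ℝ (Fin 2)) ra, F ‖x - y‖ =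
      ∫⁻ z, f z := by
    rw [← lintegral_indicator measurableSet_closedBall,
      ← lintegral_sub_left_eq_self f (‖x‖ : ℂ),
      ← e.measurePreserving.lintegral_comp (f := fun z => f (‖x‖ - z)) (by fun_prop)]
    refine lintegral_congr fun y => ?_
    have h2 : ‖(‖x‖ : ℂ) - e y‖ = ‖x - y‖ := by rw [← he, ← map_sub, e.norm_map]
    simp only [f, indicator, Metric.mem_closedBall, dist_eq_norm, sub_zero,
      sub_sub_cancel_left, norm_neg, e.norm_map, h2]
  rw [h1, ← Complex.lintegral_comp_polarCoord_symm, polarCoord_target, Measure.volume_eq_prod,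
    ← Measure.prod_restrict, lintegral_prod]
  · refine setLIntegral_congr_fun measurableSet_Ioi fun ρ hρ => ?_
    have hρ : 0 < ρ := hρ
    have hmeas : MeasurableSet {θ | ρ ^ 2 + ‖x‖ ^ 2 - 2 * ρ * ‖x‖ * cos θ ≤ ra ^ 2} :=
      measurableSet_le (by fun_prop) (by fun_prop)
    rw [inter_comm, ← Measure.restrict_apply hmeas, ← setLIntegral_one,
      ← lintegral_indicator hmeas, ← lintegral_const_mul _ (measurable_const.indicator hmeas)]
    refine lintegral_congr fun θ => ?_
    have hn : ‖Complex.polarCoord.symm (ρ, θ) - (‖x‖ : ℂ)‖ ^ 2 =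
        ρ ^ 2 + ‖x‖ ^ 2 - 2 * ρ * ‖x‖ * cos θ := by
      rw [Complex.sq_norm, Complex.polarCoord_symm_apply, Complex.normSq_apply]
      simp only [Complex.sub_re, Complex.mul_re, Complex.add_re, Complex.ofReal_re,
        Complex.ofReal_im, Complex.I_re, Complex.I_im, Complex.sub_im, Complex.mul_im,
        Complex.add_im]
      linear_combination (ρ ^ 2) * sin_sq_add_cos_sq θ
    simp only [f, indicator, Metric.mem_closedBall, dist_eq_norm, Complex.norm_polarCoord_symm,
      abs_of_pos hρ, mem_ofPred_eq, ← hn, smul_eq_mul, sq_le_sq₀ (norm_nonneg _) hra]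
    split_ifs <;> simp
  · have : Measurable (Complex.polarCoord.symm : ℝ × ℝ → ℂ) := by
      have : (Complex.polarCoord.symm : ℝ × ℝ → ℂ) =
          fun p => p.1 * (Real.cos p.2 + Real.sin p.2 * Complex.I) :=
        funext Complex.polarCoord_symm_apply
      rw [this]
      fun_prop
    exact ((ENNReal.measurable_ofReal.comp measurable_fst).mul (hf.comp this)).aemeasurable

/-- The change of variables from the horizontal to the spatial distance. -/
lemma setLIntegral_hypot {a b h : ℝ} (ha : 0 ≤ a) (hab : a ≤ b) (F : ℝ → ℝ≥0∞) :
    ∫⁻ w in Ioo √(a ^ 2 + h ^ 2) √(b ^ 2 + h ^ 2), ENNReal.ofReal w * F w =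
      ∫⁻ ρ in Ioo a b, ENNReal.ofReal ρ * F √(ρ ^ 2 + h ^ 2) := by
  have himg : (fun ρ => √(ρ ^ 2 + h ^ 2)) '' Ioo a b =
      Ioo √(a ^ 2 + h ^ 2) √(b ^ 2 + h ^ 2) := by
    ext w
    constructor
    · rintro ⟨ρ, ⟨h1, h2⟩, rfl⟩
      exact ⟨sqrt_lt_sqrt (by positivity) (by nlinarith),
        sqrt_lt_sqrt (by positivity) (by nlinarith)⟩
    · rintro ⟨h1, h2⟩
      have hw : 0 < w := (sqrt_nonneg _).trans_lt h1
      rw [sqrt_lt' hw] at h1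
      rw [lt_sqrt hw.le] at h2
      refine ⟨√(w ^ 2 - h ^ 2), ⟨lt_sqrt_of_sq_lt (by linarith), ?_⟩, ?_⟩
      · rw [sqrt_lt' (by nlinarith)]; linarith
      · show √(√(w ^ 2 - h ^ 2) ^ 2 + h ^ 2) = w
        rw [sq_sqrt (by nlinarith), sub_add_cancel, sqrt_sq hw.le]
  rw [← himg, lintegral_image_eq_lintegral_abs_deriv_mul measurableSet_Ioo
    (f' := fun ρ => ρ / √(ρ ^ 2 + h ^ 2))]
  · refine setLIntegral_congr_fun measurableSet_Ioo fun ρ hρ => ?_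
    have hρ0 : 0 < ρ := ha.trans_lt hρ.1
    have hs : 0 < √(ρ ^ 2 + h ^ 2) := sqrt_pos.2 (by positivity)
    rw [← mul_assoc, ← ENNReal.ofReal_mul (abs_nonneg _), abs_of_pos (by positivity),
      div_mul_cancel₀ _ hs.ne']
  · intro ρ hρ
    have hρ0 : 0 < ρ := ha.trans_lt hρ.1
    have h1 : HasDerivAt (fun ρ : ℝ => ρ ^ 2 + h ^ 2) (2 * ρ) ρ := by
      simpa using (hasDerivAt_pow 2 ρ).add_const (h ^ 2)
    refine ((h1.sqrt (by positivity)).congr_deriv ?_).hasDerivWithinAt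
    rw [mul_div_mul_left _ _ two_ne_zero]
  · intro ρ hρ σ hσ heq
    have h1 : 0 < ρ := ha.trans_lt hρ.1
    have h2 : 0 < σ := ha.trans_lt hσ.1
    have h3 := (sqrt_inj (by positivity) (by positivity)).1 heq
    exact (sq_eq_sq₀ h1.le h2.le).1 (by linarith)

lemma sqrt_sq_add_sq_sub (ρ h : ℝ) (hρ : 0 ≤ ρ) : √(√(ρ ^ 2 + h ^ 2) ^ 2 - h ^ 2) = ρ := by
  rw [sq_sqrt (by positivity), add_sub_cancel_right, sqrt_sq hρ]

lemma measurable_pdf₁ (ra : ℝ) : Measurable (pdf₁ ra) := by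
  unfold pdf₁; fun_prop

lemma measurable_pdf₂ (ra h x₀ : ℝ) : Measurable (pdf₂ ra h x₀) := by
  unfold pdf₂
  exact Measurable.mul (by fun_prop) (continuous_arccos.measurable.comp (by fun_prop))

lemma pdf₂_eq (ra h x₀ w : ℝ) : pdf₂ ra h x₀ w = 2 * w / (π * ra ^ 2) * thetaStar ra h x₀ w := rfl

/-- The circle of radius `ρ` around the receiver's position lies inside the disk for `ρ < ra - x₀`,
meets it in an arc of half-angle `θ*` for `ra - x₀ < ρ < ra + x₀`, and misses it beyond. The
densities are the arc lengths divided by the disk area, carried over to `w = √(ρ² + h²)` by `w dw =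
ρ dρ`. -/
lemma linkLaw_eq {ra h x₀ : ℝ} (hra : 0 < ra) (hh : 0 ≤ h) {x : EuclideanSpace ℝ (Fin 2)}
    (hx : ‖x‖ = x₀) (hx₀ : x₀ ≤ ra) :
    linkLaw ra h x =
      (volume.restrict (Ioo h (wMinus ra h x₀))).withDensity
          (fun w => ENNReal.ofReal (pdf₁ ra w)) +
        (volume.restrict (Ioo (wMinus ra h x₀) (wPlus ra h x₀))).withDensity
          (fun w => ENNReal.ofReal (pdf₂ ra h x₀ w)) := by
  have hx0 : 0 ≤ x₀ := hx ▸ norm_nonneg x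
  ext s hs
  let I : ℝ → ℝ≥0∞ := s.indicator 1
  have hI : Measurable I := measurable_one.indicator hs
  have hm₁ : Measurable fun w => ENNReal.ofReal (pdf₁ ra w) * I w :=
    (measurable_pdf₁ ra).ennreal_ofReal.mul hI
  have hm₂ : Measurable fun w => ENNReal.ofReal (pdf₂ ra h x₀ w) * I w :=
    (measurable_pdf₂ ra h x₀).ennreal_ofReal.mul hI
  have hc : (volume (Metric.closedBall (0 : EuclideanSpace ℝ (Fin 2)) ra))⁻¹ =
      ENNReal.ofReal (π * ra ^ 2)⁻¹ := by
    rw [EuclideanSpace.volume_closedBall_fin_two, ← ENNReal.ofReal_pow hra.le,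
      ← ENNReal.ofReal_mul (by positivity),
      ENNReal.ofReal_inv_of_pos (by positivity), mul_comm]
  have h1 : linkLaw ra h x s = ENNReal.ofReal (π * ra ^ 2)⁻¹ *
      ∫⁻ ρ in Ioi (0 : ℝ), ENNReal.ofReal ρ * I √(ρ ^ 2 + h ^ 2) * volume (Ioo (-π) π ∩
        {θ | ρ ^ 2 + x₀ ^ 2 - 2 * ρ * x₀ * cos θ ≤ ra ^ 2}) := by
    have hI' : Measurable fun ρ => I √(ρ ^ 2 + h ^ 2) := hI.comp (by fun_prop)
    rw [← hx, ← lintegral_disk_polar ra hra.le x hI', linkLaw, ProbabilityTheory.cond, Measure.map_smul,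
      Measure.smul_apply, smul_eq_mul, hc, ← lintegral_indicator_one hs,
      lintegral_map hI (measurable_dist_atHeight h x)]
    simp_rw [dist_atHeight]
  have hA : ∫⁻ ρ in Ioc 0 (ra - x₀), ENNReal.ofReal ρ * I √(ρ ^ 2 + h ^ 2) *
      volume (Ioo (-π) π ∩ {θ | ρ ^ 2 + x₀ ^ 2 - 2 * ρ * x₀ * cos θ ≤ ra ^ 2}) =
      ENNReal.ofReal (π * ra ^ 2) *
        ∫⁻ w in Ioo h (wMinus ra h x₀), ENNReal.ofReal (pdf₁ ra w) * I w := by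
    have h2 := setLIntegral_hypot (h := h) le_rfl (sub_nonneg.2 hx₀)
      (fun w => ENNReal.ofReal (2 * π) * I w)
    rw [show √((0 : ℝ) ^ 2 + h ^ 2) = h by simp [sqrt_sq hh]] at h2
    rw [← lintegral_const_mul _ hm₁,
      setLIntegral_congr Ioo_ae_eq_Ioc.symm]
    refine Eq.trans ?_ (h2.symm.trans ?_)
    · refine setLIntegral_congr_fun measurableSet_Ioo fun ρ hρ => ?_
      have hset : Ioo (-π) π ∩ {θ | ρ ^ 2 + x₀ ^ 2 - 2 * ρ * x₀ * cos θ ≤ ra ^ 2} =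
          Ioo (-π) π := by
        refine inter_eq_left.2 fun θ _ => ?_
        have h3 : 0 ≤ ρ * x₀ * (1 + cos θ) :=
          mul_nonneg (mul_nonneg hρ.1.le hx0) (by linarith [neg_one_le_cos θ])
        have h4 := hρ.2
        have h5 : (ρ + x₀) ^ 2 ≤ ra ^ 2 :=
          pow_le_pow_left₀ (add_nonneg hρ.1.le hx0) (by linarith) 2
        rw [mem_ofPred_eq]
        linarith
      simp only [hset, volume_Ioo]
      rw [sub_neg_eq_add, ← two_mul, mul_comm (ENNReal.ofReal (2 * π)), mul_assoc]
    · refine setLIntegral_congr_fun measurableSet_Ioo fun w hw => ?_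
      have hw0 : 0 < w := hh.trans_lt hw.1
      rw [← mul_assoc, ← mul_assoc, ← ENNReal.ofReal_mul hw0.le,
        ← ENNReal.ofReal_mul (by positivity), pdf₁]
      congr 2
      field_simp
  have hB : ∫⁻ ρ in Ioc (ra - x₀) (ra + x₀), ENNReal.ofReal ρ * I √(ρ ^ 2 + h ^ 2) *
      volume (Ioo (-π) π ∩ {θ | ρ ^ 2 + x₀ ^ 2 - 2 * ρ * x₀ * cos θ ≤ ra ^ 2}) =
      ENNReal.ofReal (π * ra ^ 2) * ∫⁻ w in Ioo (wMinus ra h x₀) (wPlus ra h x₀),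
        ENNReal.ofReal (pdf₂ ra h x₀ w) * I w := by
    have h2 := setLIntegral_hypot (h := h) (sub_nonneg.2 hx₀)
      (show ra - x₀ ≤ ra + x₀ by linarith)
      (fun w => ENNReal.ofReal (2 * thetaStar ra h x₀ w) * I w)
    rw [← lintegral_const_mul _ hm₂,
      setLIntegral_congr Ioo_ae_eq_Ioc.symm]
    refine Eq.trans ?_ (h2.symm.trans ?_)
    · refine setLIntegral_congr_fun measurableSet_Ioo fun ρ hρ => ?_
      have hρ0 : 0 < ρ := (sub_nonneg.2 hx₀).trans_lt hρ.1
      -- A point of the interval forces `x₀ > 0`, so the degenerate case `x₀ = 0` never meets a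
      -- division by zero.
      have hx1 : 0 < x₀ := by have := hρ.1.trans hρ.2; linarith
      have hθ : thetaStar ra h x₀ √(ρ ^ 2 + h ^ 2) =
          arccos ((ρ ^ 2 + x₀ ^ 2 - ra ^ 2) / (2 * x₀ * ρ)) := by
        rw [thetaStar, edgeDist, sqrt_sq_add_sq_sub _ _ hρ0.le, sq_sqrt (by positivity),
          sq_sqrt (by positivity)]
        ring_nf
      have hset : {θ | ρ ^ 2 + x₀ ^ 2 - 2 * ρ * x₀ * cos θ ≤ ra ^ 2} =
          {θ | (ρ ^ 2 + x₀ ^ 2 - ra ^ 2) / (2 * x₀ * ρ) ≤ cos θ} := by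
        ext θ
        rw [mem_ofPred_eq, mem_ofPred_eq, div_le_iff₀ (by positivity)]
        constructor <;> intro _ <;> linarith
      simp only [hset, volume_arc, hθ]
      ring
    · refine setLIntegral_congr_fun measurableSet_Ioo fun w hw => ?_
      have hw0 : 0 < w := (sqrt_nonneg _).trans_lt hw.1
      rw [← mul_assoc, ← mul_assoc, ← ENNReal.ofReal_mul hw0.le,
        ← ENNReal.ofReal_mul (by positivity), pdf₂_eq]
      congr 2
      field_simp
  have hC : ∫⁻ ρ in Ioi (ra + x₀), ENNReal.ofReal ρ * I √(ρ ^ 2 + h ^ 2) *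
      volume (Ioo (-π) π ∩ {θ | ρ ^ 2 + x₀ ^ 2 - 2 * ρ * x₀ * cos θ ≤ ra ^ 2}) = 0 := by
    rw [setLIntegral_eq_zero measurableSet_Ioi]
    intro ρ hρ
    have hρ : ra + x₀ < ρ := hρ
    have hset : Ioo (-π) π ∩ {θ | ρ ^ 2 + x₀ ^ 2 - 2 * ρ * x₀ * cos θ ≤ ra ^ 2} = ∅ := by
      refine eq_empty_of_forall_notMem fun θ hθ => ?_
      have h3 : ρ ^ 2 + x₀ ^ 2 - 2 * ρ * x₀ * cos θ ≤ ra ^ 2 := hθ.2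
      have h4 : 0 ≤ ρ * x₀ * (1 - cos θ) :=
        mul_nonneg (mul_nonneg (by linarith) hx0) (by linarith [cos_le_one θ])
      have h5 : ra ^ 2 < (ρ - x₀) ^ 2 := pow_lt_pow_left₀ (by linarith) hra.le two_ne_zero
      linarith
    simp only [hset, measure_empty, mul_zero, Pi.zero_apply]
  have hinv : ENNReal.ofReal (π * ra ^ 2)⁻¹ * ENNReal.ofReal (π * ra ^ 2) = 1 := by
    rw [← ENNReal.ofReal_mul (by positivity), inv_mul_cancel₀ (by positivity), ENNReal.ofReal_one]
  rw [h1, ← Ioc_union_Ioi_eq_Ioi (a := (0 : ℝ)) (b := ra + x₀) (by linarith),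
    lintegral_union measurableSet_Ioi (Ioc_disjoint_Ioi le_rfl), hC,
    ← Ioc_union_Ioc_eq_Ioc (sub_nonneg.2 hx₀) (show ra - x₀ ≤ ra + x₀ by linarith),
    lintegral_union measurableSet_Ioc (Ioc_disjoint_Ioc_of_le le_rfl), hA, hB, add_zero, ← mul_add,
    ← mul_assoc, hinv, one_mul, Measure.add_apply, ← lintegral_indicator_one hs,
    ← lintegral_indicator_one hs,
    lintegral_withDensity_eq_lintegral_mul _ (measurable_pdf₁ ra).ennreal_ofReal hI,
    lintegral_withDensity_eq_lintegral_mul _ (measurable_pdf₂ ra h x₀).ennreal_ofReal hI]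
  rfl

end LinkLaw

/-! ### Reduction to the closest transmitter -/

section OrderStatistics

open Set ENNReal

/-- The sorting permutation is characterised by finitely many comparisons of coordinates:
monotonicity, and ties broken by index. -/
lemma measurableSet_sort_eq {N : ℕ} (σ : Equiv.Perm (Fin N)) :
    MeasurableSet {W : Fin N → ℝ | Tuple.sort W = σ} := by
  have h : {W : Fin N → ℝ | Tuple.sort W = σ} =
      (⋂ (i) (j) (_ : i ≤ j), {W | W (σ i) ≤ W (σ j)}) ∩
        ⋂ (i) (j) (_ : i < j) (_ : ¬σ i < σ j), {W | W (σ i) = W (σ j)}ᶜ := by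
    ext W
    simp only [mem_ofPred_eq, eq_comm (a := Tuple.sort W), Tuple.eq_sort_iff, mem_inter_iff,
      mem_iInter, mem_compl_iff]
    refine and_congr ⟨fun h i j hij => h hij, fun h i j hij => h i j hij⟩ ?_
    exact forall₃_congr fun i j _ => by tauto
  rw [h]
  refine .inter (.iInter fun i => .iInter fun j => .iInter fun _ =>
    measurableSet_le (by fun_prop) (by fun_prop))
    (.iInter fun i => .iInter fun j => .iInter fun _ => .iInter fun _ =>
      (measurableSet_eq_fun (by fun_prop) (by fun_prop)).compl)

lemma measurable_ordered {N : ℕ} (i : Fin N) : Measurable fun W : Fin N → ℝ => ordered W i := by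
  intro t ht
  have h : (fun W : Fin N → ℝ => ordered W i) ⁻¹' t =
      ⋃ σ : Equiv.Perm (Fin N), {W | Tuple.sort W = σ} ∩ {W | W (σ i) ∈ t} := by
    ext W
    simp [ordered]
  rw [h]
  exact .iUnion fun σ => (measurableSet_sort_eq σ).inter (measurable_pi_apply _ ht)

lemma measurable_SIR {N : ℕ} [NeZero N] (α : ℝ) :
    Measurable fun p : (Fin N → ℝ) × (Fin N → ℝ) => SIR α p.1 p.2 := by
  have h (i : Fin N) : Measurable fun p : (Fin N → ℝ) × (Fin N → ℝ) => ordered p.1 i :=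
    (measurable_ordered i).comp measurable_fst
  unfold SIR interference
  exact Measurable.div (by have := h 0; fun_prop)
    (Finset.measurable_fun_sum _ fun i _ => by have := h i; fun_prop)

/-- Gains are attached to ranks rather than to transmitters, so relabelling the transmitters changes
nothing. -/
lemma SIR_comp_perm {N : ℕ} [NeZero N] (α : ℝ) (W g : Fin N → ℝ) (σ : Equiv.Perm (Fin N)) :
    SIR α (W ∘ σ) g = SIR α W g := by
  have h (i : Fin N) : ordered (W ∘ σ) i = ordered W i :=
    congrFun (Tuple.comp_perm_comp_sort_eq_comp_sort (f := W) (σ := σ)) i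
  simp only [SIR, interference, h]

/-- The marginals need only agree along `σ`. This covers both the i.i.d. distances and the gains,
whose zeroth marginal differs but is fixed by the ranking. -/
lemma measurePreserving_comp_perm {ι E : Type*} [Fintype ι] [MeasurableSpace E]
    (μ : ι → Measure E) [∀ i, SigmaFinite (μ i)] (σ : Equiv.Perm ι) (h : ∀ i, μ (σ i) = μ i) :
    MeasurePreserving (fun w : ι → E => w ∘ σ) (Measure.pi μ) (Measure.pi μ) := by
  have hm : Measurable fun w : ι → E => w ∘ σ :=
    measurable_pi_lambda _ fun i => measurable_pi_apply _
  refine ⟨hm, (Measure.pi_eq fun s hs => ?_).symm⟩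
  have hpre : (fun w : ι → E => w ∘ σ) ⁻¹' univ.pi s = univ.pi fun i => s (σ.symm i) := by
    ext w
    simp only [mem_preimage, mem_pi, mem_univ, true_imp_iff, Function.comp]
    exact ⟨fun hw i => by simpa using hw (σ.symm i), fun hw i => by simpa using hw (σ i)⟩
  rw [Measure.map_apply hm (.univ_pi hs), hpre, Measure.pi_pi, ← Equiv.prod_comp σ]
  simp [h]

variable {n : ℕ}

/-- The configurations in which transmitter `j` is strictly the closest. -/
def closestSet (j : Fin (n + 1)) : Set (Fin (n + 1) → ℝ) := {w | ∀ i, i ≠ j → w j < w i}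

lemma measurableSet_closestSet (j : Fin (n + 1)) : MeasurableSet (closestSet j) := by
  simp only [closestSet, ofPred_forall]
  exact .iInter fun i => .iInter fun _ => measurableSet_lt (by fun_prop) (by fun_prop)

lemma pairwise_disjoint_closestSet :
    Pairwise (Function.onFun Disjoint (closestSet (n := n))) := fun i j hij =>
  disjoint_left.2 fun _ hi hj => lt_asymm (hi j hij.symm) (hj i hij)

/-- With all other coordinates frozen, a tie pins coordinate `i` to one point, which is null for an
atomless law. -/
lemma ae_ne_of_ne (μ : Measure ℝ) [IsProbabilityMeasure μ] [NullSingletonClass μ] {i j : Fin (n + 1)}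
    (hij : j ≠ i) : ∀ᵐ w ∂Measure.pi fun _ : Fin (n + 1) => μ, w i ≠ w j := by
  obtain ⟨k, rfl⟩ := Fin.exists_succAbove_eq hij
  have h : ∀ᵐ p ∂μ.prod (Measure.pi fun _ : Fin n => μ), p.1 ≠ p.2 k := by
    have hs : MeasurableSet {p : ℝ × (Fin n → ℝ) | p.1 = p.2 k} :=
      measurableSet_eq_fun (by fun_prop) (by fun_prop)
    rw [ae_iff]
    simp only [ne_eq, not_not]
    rw [Measure.prod_apply_symm hs]
    simp [preimage]
  exact (measurePreserving_piFinSuccAbove (fun _ => μ) i).quasiMeasurePreserving.ae h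

lemma iUnion_closestSet_ae_eq (μ : Measure ℝ) [IsProbabilityMeasure μ] [NullSingletonClass μ] :
    (⋃ j, closestSet (n := n) j) =ᵐ[Measure.pi fun _ => μ] univ := by
  have h : ∀ᵐ w ∂Measure.pi fun _ : Fin (n + 1) => μ, ∀ i j, j ≠ i → w i ≠ w j :=
    ae_all_iff.2 fun i => ae_all_iff.2 fun j => Filter.eventually_imp_distrib_left.2 fun hij =>
      ae_ne_of_ne μ hij
  refine Filter.eventuallyEq_univ.2 ?_
  filter_upwards [h] with w hw
  obtain ⟨j, hj⟩ := Finite.exists_min w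
  exact mem_iUnion.2 ⟨j, fun i hi => (hj i).lt_of_ne (hw j i hi)⟩

lemma sum_erase_zero (f : Fin (n + 1) → ℝ) :
    ∑ i ∈ Finset.univ.erase 0, f i = ∑ k : Fin n, f k.succ := by
  have h := Finset.add_sum_erase Finset.univ f (Finset.mem_univ 0)
  rw [Fin.sum_univ_succ] at h
  exact add_left_cancel h

/-- Interference of transmitters at distances `p.1` with gains `p.2`. -/
def interf (α : ℝ) (p : (Fin n → ℝ) × (Fin n → ℝ)) : ℝ := ∑ k, p.2 k * p.1 k ^ (-α)

lemma measurable_interf (α : ℝ) : Measurable (interf (n := n) α) := by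
  unfold interf
  fun_prop

lemma sort_zero_of_mem_closestSet {w : Fin (n + 1) → ℝ} (hw : w ∈ closestSet 0) :
    Tuple.sort w 0 = 0 := by
  by_contra hne
  have h := Tuple.monotone_sort w (Fin.zero_le ((Tuple.sort w).symm 0))
  simp only [Function.comp, Equiv.apply_symm_apply] at h
  exact absurd (hw _ hne) h.not_gt

/-- Composing the gains with the sort hands each transmitter its own gain, so the sum over ranks
reindexes to a sum over transmitters and the sorting disappears. -/
lemma SIR_comp_sort {w : Fin (n + 1) → ℝ} (hw : w ∈ closestSet 0) (α : ℝ)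
    (g : Fin (n + 1) → ℝ) :
    SIR α w (g ∘ Tuple.sort w) =
      g 0 * w 0 ^ (-α) / interf α (fun k => w k.succ, fun k => g k.succ) := by
  have h0 := sort_zero_of_mem_closestSet hw
  have h : interference α w (g ∘ Tuple.sort w) =
      ∑ i ∈ Finset.univ.erase 0, g i * w i ^ (-α) := by
    refine Finset.sum_equiv (Tuple.sort w) (fun i => ?_) fun i _ => rfl
    simp only [Finset.mem_erase, Finset.mem_univ, and_true, ne_eq]
    rw [← h0, (Tuple.sort w).injective.eq_iff, h0]
  rw [SIR, h, sum_erase_zero]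
  simp only [Function.comp, ordered, h0, interf]

variable (μ γ₀ γ : Measure ℝ)

/-- The law of distances and gains of `n` interferers, restricted to distances beyond `r`. -/
def interfLaw (n : ℕ) (r : ℝ) : Measure ((Fin n → ℝ) × (Fin n → ℝ)) :=
  (Measure.pi fun _ => μ.restrict (Ioi r)).prod (Measure.pi fun _ => γ)

/-- Probability that the other `n` transmitters are farther than `r` and that the link of length
`r` is covered. -/
def condCoverage (n : ℕ) (α β r : ℝ) : ℝ≥0∞ :=
  ∫⁻ p, γ₀ {g | β < g * r ^ (-α) / interf α p} ∂interfLaw μ γ n r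

variable [IsProbabilityMeasure μ] [IsProbabilityMeasure γ₀] [IsProbabilityMeasure γ]

instance (r : ℝ) : IsFiniteMeasure (interfLaw μ γ n r) := by
  unfold interfLaw; infer_instance

lemma measurableSet_coverage (n : ℕ) (α β : ℝ) :
    MeasurableSet {q : (ℝ × (Fin n → ℝ)) × (ℝ × (Fin n → ℝ)) | (∀ k, q.1.1 < q.1.2 k) ∧
      β < q.2.1 * q.1.1 ^ (-α) / interf α (q.1.2, q.2.2)} := by
  have := measurable_interf (n := n) α
  have h : MeasurableSet {q : (ℝ × (Fin n → ℝ)) × (ℝ × (Fin n → ℝ)) | ∀ k, q.1.1 < q.1.2 k} := by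
    simp only [ofPred_forall]
    exact .iInter fun k => measurableSet_lt (by fun_prop) (by fun_prop)
  have h' : MeasurableSet {q : (ℝ × (Fin n → ℝ)) × (ℝ × (Fin n → ℝ)) |
      β < q.2.1 * q.1.1 ^ (-α) / interf α (q.1.2, q.2.2)} :=
    measurableSet_lt (by fun_prop) (by fun_prop)
  exact h.inter h'

/-- Moving the constraint from the `r`-dependent measure into the event makes measurability in `r`
accessible and matches the integrand of the full product law. -/
lemma condCoverage_eq_lintegral (α β r : ℝ) :
    condCoverage μ γ₀ γ n α β r = ∫⁻ u : Fin n → ℝ, (γ₀.prod (Measure.pi fun _ => γ))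
      {q | (∀ k, r < u k) ∧ β < q.1 * r ^ (-α) / interf α (u, q.2)} ∂Measure.pi fun _ => μ := by
  have hI := measurable_interf (n := n) α
  have hS : MeasurableSet {p : ((Fin n → ℝ) × (Fin n → ℝ)) × ℝ |
      β < p.2 * r ^ (-α) / interf α p.1} := measurableSet_lt (by fun_prop) (by fun_prop)
  have hpi : MeasurableSet (univ.pi fun _ : Fin n => Ioi r) := .univ_pi fun _ => measurableSet_Ioi
  have hm : Measurable fun p : (Fin n → ℝ) × (Fin n → ℝ) =>
      γ₀ {g | β < g * r ^ (-α) / interf α p} := measurable_measure_prodMk_left hS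
  rw [condCoverage, interfLaw, lintegral_prod _ hm.aemeasurable, ← Measure.restrict_pi_pi,
    ← lintegral_indicator hpi]
  refine lintegral_congr fun u => ?_
  by_cases hu : ∀ k, r < u k
  · rw [indicator_of_mem (by simpa using hu)]
    simp only [hu, implies_true, true_and]
    have hS' : MeasurableSet {q : ℝ × (Fin n → ℝ) |
        β < q.1 * r ^ (-α) / interf α (u, q.2)} := measurableSet_lt (by fun_prop) (by fun_prop)
    rw [Measure.prod_apply_symm hS']
    rfl
  · rw [indicator_of_notMem (by simpa using hu)]
    simp [hu]

lemma measurable_condCoverage (α β : ℝ) : Measurable (condCoverage μ γ₀ γ n α β) := by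
  have h := (measurable_measure_prodMk_left (ν := γ₀.prod (Measure.pi fun _ => γ))
    (measurableSet_coverage n α β)).lintegral_prod_right' (ν := Measure.pi fun _ : Fin n => μ)
  convert h using 1
  exact funext fun r => condCoverage_eq_lintegral μ γ₀ γ α β r

lemma condCoverage_le_one (α β r : ℝ) : condCoverage μ γ₀ γ n α β r ≤ 1 := by
  rw [condCoverage_eq_lintegral]
  exact (lintegral_mono fun u => prob_le_one).trans_eq (by simp)

instance (i : Fin (n + 1)) : IsProbabilityMeasure
    (Fin.cons (α := fun _ => Measure ℝ) γ₀ (fun _ : Fin n => γ) i) := by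
  refine Fin.cases ?_ (fun k => ?_) i
  · simpa
  · simpa

lemma measurePreserving_split (ν₀ ν : Measure ℝ) [IsProbabilityMeasure ν₀]
    [IsProbabilityMeasure ν] :
    MeasurePreserving (fun g : Fin (n + 1) → ℝ => (g 0, fun k : Fin n => g k.succ))
      (Measure.pi (Fin.cons (α := fun _ => Measure ℝ) ν₀ fun _ : Fin n => ν))
      (ν₀.prod (Measure.pi fun _ => ν)) := by
  simpa using! measurePreserving_piFinSuccAbove
    (Fin.cons (α := fun _ => Measure ℝ) ν₀ fun _ : Fin n => ν) 0

/-- Coverage by the closest of `n + 1` transmitters, conditioned on its distance. -/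
theorem measure_SIR_gt [NullSingletonClass μ] (α β : ℝ) :
    ((Measure.pi fun _ : Fin (n + 1) => μ).prod
      (Measure.pi (Fin.cons (α := fun _ => Measure ℝ) γ₀ fun _ : Fin n => γ)))
        {p | β < SIR α p.1 p.2} =
      (n + 1) * ∫⁻ r, condCoverage μ γ₀ γ n α β r ∂μ := by
  set Γ := Measure.pi (Fin.cons (α := fun _ => Measure ℝ) γ₀ fun _ : Fin n => γ) with hΓ
  set M := Measure.pi fun _ : Fin (n + 1) => μ with hM
  have hS : MeasurableSet {p : (Fin (n + 1) → ℝ) × (Fin (n + 1) → ℝ) | β < SIR α p.1 p.2} :=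
    measurableSet_lt measurable_const (measurable_SIR α)
  set Φ : (Fin (n + 1) → ℝ) → ℝ≥0∞ := fun w => Γ {g | β < SIR α w g} with hΦ
  have hΦm : Measurable Φ := measurable_measure_prodMk_left hS
  -- Exchangeability: swapping `0` and `j` preserves the law of the distances and the ratio.
  have hperm (j : Fin (n + 1)) :
      ∫⁻ w in closestSet j, Φ w ∂M = ∫⁻ w in closestSet 0, Φ w ∂M := by
    have hmp := measurePreserving_comp_perm (fun _ : Fin (n + 1) => μ) (Equiv.swap 0 j)
      fun _ => rfl
    rw [← hmp.setLIntegral_comp_preimage (measurableSet_closestSet 0) hΦm]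
    have hpre : (fun w : Fin (n + 1) → ℝ => w ∘ Equiv.swap 0 j) ⁻¹' closestSet 0 =
        closestSet j := by
      ext w
      simp only [closestSet, mem_preimage, mem_ofPred_eq, Function.comp, Equiv.swap_apply_left]
      constructor
      · intro h i hi
        have := h (Equiv.swap 0 j i) fun h0 => hi (by
          rw [Equiv.swap_apply_eq_iff.1 h0, Equiv.swap_apply_left])
        simpa using this
      · intro h i hi
        exact h _ fun h0 => hi (by
          rw [← Equiv.swap_apply_self 0 j i, h0, Equiv.swap_apply_right])
    rw [hpre]
    simp only [hΦ, SIR_comp_perm]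
    rfl
  have hmin : ∫⁻ w in closestSet 0, Φ w ∂M = ∫⁻ r, condCoverage μ γ₀ γ n α β r ∂μ := by
    set T := {q : (ℝ × (Fin n → ℝ)) × (ℝ × (Fin n → ℝ)) | (∀ k, q.1.1 < q.1.2 k) ∧
      β < q.2.1 * q.1.1 ^ (-α) / interf α (q.1.2, q.2.2)}
    have hT : MeasurableSet T := measurableSet_coverage n α β
    have hTm := measurable_measure_prodMk_left (ν := γ₀.prod (Measure.pi fun _ => γ)) hT
    have hsplit : MeasurePreserving (fun g : Fin (n + 1) → ℝ => (g 0, fun k : Fin n => g k.succ))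
        M (μ.prod (Measure.pi fun _ => μ)) := by
      have h := measurePreserving_split (n := n) μ μ
      rwa [show (Fin.cons (α := fun _ => Measure ℝ) μ fun _ : Fin n => μ) = fun _ => μ from
        funext fun i => by refine Fin.cases ?_ (fun k => ?_) i <;> simp] at h
    have h1 : ∫⁻ r, condCoverage μ γ₀ γ n α β r ∂μ =
        ∫⁻ p, (γ₀.prod (Measure.pi fun _ => γ)) (Prod.mk p ⁻¹' T)
          ∂μ.prod (Measure.pi fun _ => μ) := by
      rw [lintegral_prod _ hTm.aemeasurable]
      exact lintegral_congr fun r => condCoverage_eq_lintegral μ γ₀ γ α β r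
    rw [h1, ← hsplit.lintegral_comp hTm, ← lintegral_indicator (measurableSet_closestSet 0)]
    refine lintegral_congr fun w => ?_
    by_cases hw : w ∈ closestSet 0
    · have hw' : ∀ k : Fin n, w 0 < w k.succ := fun k => hw _ (Fin.succ_ne_zero k)
      rw [indicator_of_mem hw, hΦ]
      -- For frozen distances the sort is a fixed permutation with `0 ↦ 0`, so it preserves the law
      -- of the gains.
      have hmp := measurePreserving_comp_perm
        (Fin.cons (α := fun _ => Measure ℝ) γ₀ fun _ : Fin n => γ) (Tuple.sort w) fun i => by
          have h0 := sort_zero_of_mem_closestSet hw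
          rcases Fin.eq_zero_or_eq_succ i with rfl | ⟨k, rfl⟩
          · rw [h0]
          · obtain ⟨l, hl⟩ := Fin.exists_succ_eq.2 (show Tuple.sort w k.succ ≠ 0 from fun h => by
              rw [← h0, (Tuple.sort w).injective.eq_iff] at h
              exact Fin.succ_ne_zero k h)
            rw [← hl, Fin.cons_succ, Fin.cons_succ]
      have hSw : MeasurableSet {g | β < SIR α w g} := measurable_prodMk_left hS
      have hTw := measurable_prodMk_left (x := (w 0, fun k : Fin n => w k.succ)) hT
      simp only
      rw [← hmp.measure_preimage hSw.nullMeasurableSet,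
        ← (measurePreserving_split γ₀ γ).measure_preimage hTw.nullMeasurableSet]
      congr 1
      ext g
      simp only [mem_preimage, mem_ofPred_eq, SIR_comp_sort hw, T, hw', implies_true, true_and]
    · rw [indicator_of_notMem hw]
      have hw' : ¬∀ k : Fin n, w 0 < w k.succ := fun h => hw fun i hi => by
        obtain ⟨k, rfl⟩ := Fin.exists_succ_eq.2 hi
        exact h k
      have : Prod.mk (w 0, fun k : Fin n => w k.succ) ⁻¹' T = ∅ :=
        eq_empty_of_forall_notMem fun q hq => hw' hq.1
      rw [this, measure_empty]
  calc (M.prod Γ) {p | β < SIR α p.1 p.2} = ∫⁻ w, Φ w ∂M := Measure.prod_apply hS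
    _ = ∑ j, ∫⁻ w in closestSet j, Φ w ∂M := by
      rw [← setLIntegral_univ, ← setLIntegral_congr (iUnion_closestSet_ae_eq μ),
        lintegral_iUnion measurableSet_closestSet pairwise_disjoint_closestSet, tsum_fintype]
    _ = (n + 1) * ∫⁻ r, condCoverage μ γ₀ γ n α β r ∂μ := by
      simp only [hperm, hmin, Finset.sum_const, Finset.card_univ, Fintype.card_fin, nsmul_eq_mul]
      push_cast
      rfl

end OrderStatistics

/-! ### Coverage at a given distance in terms of a Laplace transform -/

section Laplace

open Real Set Filter Topology

variable {n m₀ : ℕ} {m r α β s : ℝ} (μ : Measure ℝ) [IsProbabilityMeasure μ]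

lemma ae_pi_forall {ν : Measure ℝ} [SigmaFinite ν] (n : ℕ) {p : ℝ → Prop} (h : ∀ᵐ u ∂ν, p u) :
    ∀ᵐ w ∂Measure.pi fun _ : Fin n => ν, ∀ k, p (w k) :=
  ae_all_iff.2 fun k => (Measure.tendsto_eval_ae_ae (μ := fun _ : Fin n => ν) (i := k)).eventually h

lemma ae_interfLaw (n : ℕ) (m r : ℝ) (hm : 0 < m) :
    ∀ᵐ p ∂interfLaw μ (gammaMeasure m m) n r, ∀ k, r < p.1 k ∧ 0 < p.2 k := by
  have := isProbabilityMeasure_gammaMeasure hm hm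
  have h1 : ∀ᵐ u ∂μ.restrict (Ioi r), r < u := ae_restrict_mem measurableSet_Ioi
  filter_upwards [Measure.quasiMeasurePreserving_fst.ae (ae_pi_forall n h1),
    Measure.quasiMeasurePreserving_snd.ae (ae_pi_forall n (ae_pos_gammaMeasure m m))]
    with p hp hp' k using ⟨hp k, hp' k⟩

lemma interf_nonneg (α : ℝ) (hr : 0 < r) {p : (Fin n → ℝ) × (Fin n → ℝ)}
    (hp : ∀ k, r < p.1 k ∧ 0 < p.2 k) : 0 ≤ interf α p :=
  Finset.sum_nonneg fun k _ => mul_nonneg (hp k).2.le (rpow_nonneg (hr.trans (hp k).1).le _)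

lemma interf_pos (α : ℝ) (hn : 1 ≤ n) (hr : 0 < r) {p : (Fin n → ℝ) × (Fin n → ℝ)}
    (hp : ∀ k, r < p.1 k ∧ 0 < p.2 k) : 0 < interf α p := by
  have : Nonempty (Fin n) := ⟨⟨0, hn⟩⟩
  exact Finset.sum_pos (fun k _ => mul_pos (hp k).2 (rpow_pos_of_pos (hr.trans (hp k).1) _))
    Finset.univ_nonempty

lemma integrable_exp_interf (n : ℕ) (α : ℝ) (hm : 0 < m) (hr : 0 < r) {t : ℝ} (ht : t ≤ 0) :
    Integrable (fun p => exp (t * interf α p)) (interfLaw μ (gammaMeasure m m) n r) := by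
  have := isProbabilityMeasure_gammaMeasure hm hm
  refine Integrable.of_bound (measurable_exp.comp
    ((measurable_interf α).const_mul t)).aestronglyMeasurable 1 ?_
  filter_upwards [ae_interfLaw μ n m r hm] with p hp
  rw [norm_of_nonneg (exp_nonneg _), exp_le_one_iff]
  exact mul_nonpos_of_nonpos_of_nonneg ht (interf_nonneg α hr hp)

/-- Interference is almost surely nonnegative, so the exponential moment is finite on a whole
half-line. Interiority is what yields analyticity and derivatives as moments. -/
lemma neg_mem_interior_integrableExpSet (n : ℕ) (α : ℝ) (hm : 0 < m) (hr : 0 < r) (hs : 0 < s) :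
    -s ∈ interior (integrableExpSet (interf α) (interfLaw μ (gammaMeasure m m) n r)) :=
  mem_interior.2 ⟨Iio 0, fun _ ht => integrable_exp_interf μ n α hm hr (le_of_lt ht), isOpen_Iio,
    by simpa using hs⟩

/-- The exponential of the sum is a product over interferers. Integrating out each gain leaves its
gamma Laplace transform, and the distances are i.i.d. under the restricted law. -/
lemma mgf_interf (n : ℕ) (α : ℝ) (hm : 0 < m) (hr : 0 < r) (hs : 0 ≤ s) :
    mgf (interf α) (interfLaw μ (gammaMeasure m m) n r) (-s) =
      (∫ u in Ioi r, (1 + s * u ^ (-α) / m) ^ (-m) ∂μ) ^ n := by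
  have := isProbabilityMeasure_gammaMeasure hm hm
  have hint := integrable_exp_interf μ n α hm hr (neg_nonpos.2 hs)
  rw [mgf]
  unfold interfLaw at hint ⊢
  rw [integral_prod _ hint]
  have hae : ∀ᵐ u ∂Measure.pi fun _ : Fin n => μ.restrict (Ioi r), ∀ k, r < u k :=
    ae_pi_forall n (ae_restrict_mem measurableSet_Ioi)
  have h1 : ∀ᵐ u ∂Measure.pi fun _ : Fin n => μ.restrict (Ioi r),
      ∫ g, exp (-s * interf α (u, g)) ∂Measure.pi (fun _ => gammaMeasure m m) =
        ∏ k, (1 + s * u k ^ (-α) / m) ^ (-m) := by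
    filter_upwards [hae] with u hu
    have h2 (g : Fin n → ℝ) : exp (-s * interf α (u, g)) =
        ∏ k, exp (-(s * u k ^ (-α) * g k)) := by
      rw [← exp_sum, interf, Finset.mul_sum]
      congr 1
      exact Finset.sum_congr rfl fun k _ => by ring
    simp only [h2]
    rw [integral_fintype_prod_eq_prod (f := fun k g => exp (-(s * u k ^ (-α) * g)))]
    exact Finset.prod_congr rfl fun k _ => integral_exp_neg_mul_gammaMeasure hm hm
      (mul_nonneg hs (rpow_nonneg (hr.trans (hu k)).le _))
  rw [integral_congr_ae h1,
    integral_fintype_prod_eq_pow (f := fun u : ℝ => (1 + s * u ^ (-α) / m) ^ (-m)),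
    Fintype.card_fin]

lemma toReal_condCoverage (hn : 1 ≤ n) (hm₀ : 1 ≤ m₀) (hm : 0 < m) (hr : 0 < r) (hβ : 0 < β) :
    (condCoverage μ (gammaMeasure m₀ m₀) (gammaMeasure m m) n α β r).toReal =
      ∑ k ∈ Finset.range m₀, (-(m₀ * β * r ^ α)) ^ k / (k.factorial : ℝ) *
        iteratedDeriv k (fun s => mgf (interf α) (interfLaw μ (gammaMeasure m m) n r) (-s))
          (m₀ * β * r ^ α) := by
  have hm₀' : (0 : ℝ) < m₀ := by exact_mod_cast hm₀
  have := isProbabilityMeasure_gammaMeasure hm hm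
  have := isProbabilityMeasure_gammaMeasure hm₀' hm₀'
  have hrα : 0 < r ^ α := rpow_pos_of_pos hr α
  set s := m₀ * β * r ^ α with hs
  have hs0 : 0 < s := by positivity
  have hI := measurable_interf (n := n) α
  have hS : MeasurableSet {p : ((Fin n → ℝ) × (Fin n → ℝ)) × ℝ |
      β < p.2 * r ^ (-α) / interf α p.1} := measurableSet_lt (by fun_prop) (by fun_prop)
  have hmeas : Measurable fun p : (Fin n → ℝ) × (Fin n → ℝ) =>
      gammaMeasure m₀ m₀ {g | β < g * r ^ (-α) / interf α p} :=
    measurable_measure_prodMk_left hS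
  have htail : ∀ᵐ p ∂interfLaw μ (gammaMeasure m m) n r,
      (gammaMeasure m₀ m₀ {g | β < g * r ^ (-α) / interf α p}).toReal =
        ∑ k ∈ Finset.range m₀, s ^ k / (k.factorial : ℝ) *
          (interf α p ^ k * exp (-s * interf α p)) := by
    filter_upwards [ae_interfLaw μ n m r hm] with p hp
    -- Clearing the denominator needs `n ≥ 1`: with no interferers the quotient would be `0` by
    -- convention.
    have hX := interf_pos α hn hr hp
    have hset : {g | β < g * r ^ (-α) / interf α p} = Ioi (β * r ^ α * interf α p) := by
      ext g
      rw [mem_ofPred_eq, mem_Ioi, lt_div_iff₀ hX, rpow_neg hr.le, ← div_eq_mul_inv,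
        lt_div_iff₀ hrα]
      ring_nf
    rw [hset, ← measureReal_def, gammaMeasure_real_Ioi hm₀ hm₀' (by positivity)]
    refine Finset.sum_congr rfl fun k _ => ?_
    rw [show (m₀ : ℝ) * (β * r ^ α * interf α p) = s * interf α p by rw [hs]; ring, mul_pow,
      neg_mul]
    ring
  have hmem := neg_mem_interior_integrableExpSet μ n α hm hr hs0
  rw [condCoverage, ← integral_toReal hmeas.aemeasurable (ae_of_all _ fun p => measure_lt_top _ _),
    integral_congr_ae htail, integral_finsetSum _ fun k _ =>
      (integrable_pow_mul_exp_of_mem_interior_integrableExpSet hmem k).const_mul _]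
  refine Finset.sum_congr rfl fun k _ => ?_
  rw [integral_const_mul, iteratedDeriv_comp_neg, iteratedDeriv_mgf hmem, smul_eq_mul, neg_pow s]
  -- The sign from differentiating at `-s` cancels the sign in `(-s) ^ k`.
  have : ((-1 : ℝ) ^ k) * (-1) ^ k = 1 := by rw [← mul_pow]; simp
  linear_combination (-(s ^ k / (k.factorial : ℝ) *
    ∫ p, interf α p ^ k * exp (-s * interf α p) ∂interfLaw μ (gammaMeasure m m) n r)) * this

variable {L : ℝ → ℝ}

/-- A formula valid for positive `s` determines the germ of `L`, hence all its derivatives there. -/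
lemma eventuallyEq_mgf_interf (hm : 0 < m) (hr : 0 < r)
    (hL : ∀ s, 0 < s →
      L s = ((∫ u in Ioi r, (1 + s * u ^ (-α) / m) ^ (-m) ∂μ) / μ.real (Ioi r)) ^ n)
    (hs : 0 < s) :
    L =ᶠ[𝓝 s] fun s => (μ.real (Ioi r) ^ n)⁻¹ *
      mgf (interf α) (interfLaw μ (gammaMeasure m m) n r) (-s) := by
  filter_upwards [lt_mem_nhds hs] with t ht
  rw [hL t ht, mgf_interf μ n α hm hr ht.le, div_pow, div_eq_inv_mul]

lemma contDiffAt_of_eq_laplace (hm : 0 < m) (hr : 0 < r)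
    (hL : ∀ s, 0 < s →
      L s = ((∫ u in Ioi r, (1 + s * u ^ (-α) / m) ^ (-m) ∂μ) / μ.real (Ioi r)) ^ n)
    (hs : 0 < s) (k : ℕ) : ContDiffAt ℝ k L s := by
  refine ContDiffAt.congr_of_eventuallyEq ?_ (eventuallyEq_mgf_interf μ hm hr hL hs)
  exact contDiffAt_const.mul ((analyticAt_mgf
    (neg_mem_interior_integrableExpSet μ n α hm hr hs)).contDiffAt.comp s contDiffAt_id.neg)

lemma sum_iteratedDeriv_laplace (hn : 1 ≤ n) (hm₀ : 1 ≤ m₀) (hm : 0 < m) (hr : 0 < r)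
    (hβ : 0 < β) (hL : ∀ s, 0 < s →
      L s = ((∫ u in Ioi r, (1 + s * u ^ (-α) / m) ^ (-m) ∂μ) / μ.real (Ioi r)) ^ n) :
    (∑ k ∈ Finset.range m₀, (-(m₀ * β * r ^ α)) ^ k / (k.factorial : ℝ) *
        iteratedDeriv k L (m₀ * β * r ^ α)) * μ.real (Ioi r) ^ n =
      (condCoverage μ (gammaMeasure m₀ m₀) (gammaMeasure m m) n α β r).toReal := by
  have hm₀' : (0 : ℝ) < m₀ := by exact_mod_cast hm₀
  have hs : 0 < m₀ * β * r ^ α := by have := rpow_pos_of_pos hr α; positivity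
  have h1 (k : ℕ) := (eventuallyEq_mgf_interf μ hm hr hL hs).iteratedDeriv_eq k
  simp only [h1, iteratedDeriv_const_mul_field]
  -- With zero mass the normalisation cannot be cancelled, but both sides vanish: since `n ≥ 1`, the
  -- product of the restricted laws is the zero measure.
  by_cases hc : μ.real (Ioi r) = 0
  · have h0 : μ.restrict (Ioi r) = 0 := by
      rw [Measure.restrict_eq_zero]
      exact (measureReal_eq_zero_iff).1 hc
    rw [hc, zero_pow (by omega), mul_zero, condCoverage, interfLaw, h0]
    have : (Measure.pi fun _ : Fin n => (0 : Measure ℝ)) = 0 := by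
      rw [← Measure.measure_univ_eq_zero, Measure.pi_univ]
      simp; omega
    simp [this]
  · rw [toReal_condCoverage μ hn hm₀ hm hr hβ, Finset.sum_mul]
    refine Finset.sum_congr rfl fun k _ => ?_
    have := pow_ne_zero n hc
    field_simp

end Laplace

/-! ### Distribution functions of the link distance -/

section Distribution

open Real Set

variable {ra h x₀ : ℝ}

lemma le_wMinus : h ≤ wMinus ra h x₀ := by
  rw [wMinus]
  exact le_sqrt_of_sq_le (by nlinarith [sq_nonneg (ra - x₀)])

lemma wMinus_le_wPlus (hra : 0 < ra) (hx0 : 0 ≤ x₀) : wMinus ra h x₀ ≤ wPlus ra h x₀ :=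
  sqrt_le_sqrt (by nlinarith)

lemma pdf₁_nonneg {w : ℝ} (hw : 0 ≤ w) : 0 ≤ pdf₁ ra w := by
  rw [pdf₁]; positivity

lemma pdf₂_nonneg {w : ℝ} (hw : 0 ≤ w) : 0 ≤ pdf₂ ra h x₀ w := by
  have := arccos_nonneg ((w ^ 2 + x₀ ^ 2 - edgeDist ra h ^ 2) / (2 * x₀ * √(w ^ 2 - h ^ 2)))
  have := pi_pos
  rw [pdf₂]; positivity

instance isProbabilityMeasure_linkLaw [hra : Fact (0 < ra)] (h : ℝ)
    (x : EuclideanSpace ℝ (Fin 2)) : IsProbabilityMeasure (linkLaw ra h x) := by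
  have : IsProbabilityMeasure
      (volume[|Metric.closedBall (0 : EuclideanSpace ℝ (Fin 2)) ra]) :=
    cond_isProbabilityMeasure_of_finite (Metric.measure_closedBall_pos _ _ hra.out).ne'
      measure_closedBall_lt_top.ne
  exact Measure.isProbabilityMeasure_map (measurable_dist_atHeight h x).aemeasurable

lemma integrable_withDensity_ofReal {s : Set ℝ} (hs : MeasurableSet s) {f g : ℝ → ℝ}
    (hf : Measurable f) (hf0 : ∀ u ∈ s, 0 ≤ f u)
    (hg : Integrable g ((volume.restrict s).withDensity fun u => ENNReal.ofReal (f u))) :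
    IntegrableOn (fun u => g u * f u) s ∧
      ∫ u, g u ∂(volume.restrict s).withDensity (fun u => ENNReal.ofReal (f u)) =
        ∫ u in s, g u * f u := by
  have hc : EqOn (fun u => (ENNReal.ofReal (f u)).toReal • g u) (fun u => g u * f u) s :=
    fun u hu => by simp [ENNReal.toReal_ofReal (hf0 u hu), mul_comm]
  constructor
  · rw [integrable_withDensity_iff_integrable_smul' hf.ennreal_ofReal (by simp)] at hg
    exact (integrableOn_congr_fun hc hs).1 hg
  · rw [integral_withDensity_eq_integral_toReal_smul hf.ennreal_ofReal (by simp)]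
    exact setIntegral_congr_fun hs hc

variable {x : EuclideanSpace ℝ (Fin 2)}

lemma integral_linkLaw (hra : 0 < ra) (hh : 0 ≤ h) (hx : ‖x‖ = x₀) (hx₀ : x₀ ≤ ra) {g : ℝ → ℝ}
    (hg : Integrable g (linkLaw ra h x)) :
    IntegrableOn (fun u => g u * pdf₁ ra u) (Ioo h (wMinus ra h x₀)) ∧
    IntegrableOn (fun u => g u * pdf₂ ra h x₀ u) (Ioo (wMinus ra h x₀) (wPlus ra h x₀)) ∧
    ∫ u, g u ∂linkLaw ra h x = (∫ u in Ioo h (wMinus ra h x₀), g u * pdf₁ ra u) +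
      ∫ u in Ioo (wMinus ra h x₀) (wPlus ra h x₀), g u * pdf₂ ra h x₀ u := by
  rw [linkLaw_eq hra hh hx hx₀] at hg ⊢
  rw [integrable_add_measure] at hg
  have h1 := integrable_withDensity_ofReal measurableSet_Ioo (measurable_pdf₁ ra)
    (fun u hu => pdf₁_nonneg (hh.trans hu.1.le)) hg.1
  have h2 := integrable_withDensity_ofReal measurableSet_Ioo (measurable_pdf₂ ra h x₀)
    (fun u hu => pdf₂_nonneg (hh.trans (le_wMinus.trans hu.1.le))) hg.2
  exact ⟨h1.1, h2.1, by rw [integral_add_measure hg.1 hg.2, h1.2, h2.2]⟩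

lemma setIntegral_Ioo_indicator_Ioi {a b r : ℝ} (har : a ≤ r) (hrb : r ≤ b) (f g : ℝ → ℝ) :
    ∫ u in Ioo a b, (Ioi r).indicator g u * f u = ∫ u in r..b, g u * f u := by
  have h1 : (fun u => (Ioi r).indicator g u * f u) = (Ioi r).indicator fun u => g u * f u := by
    ext u
    by_cases hu : u ∈ Ioi r <;> simp [hu]
  rw [h1, setIntegral_indicator measurableSet_Ioi, Ioo_inter_Ioi, max_eq_right har,
    intervalIntegral.integral_of_le hrb, integral_Ioc_eq_integral_Ioo]

lemma setIntegral_Ioi_linkLaw_of_le_wMinus (hra : 0 < ra) (hh : 0 ≤ h) (hx : ‖x‖ = x₀)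
    (hx₀ : x₀ ≤ ra) {r : ℝ} (hr : r ∈ Icc h (wMinus ra h x₀)) {g : ℝ → ℝ}
    (hg : IntegrableOn g (Ioi r) (linkLaw ra h x)) :
    ∫ u in Ioi r, g u ∂linkLaw ra h x = (∫ u in r..wMinus ra h x₀, g u * pdf₁ ra u) +
      ∫ u in wMinus ra h x₀..wPlus ra h x₀, g u * pdf₂ ra h x₀ u := by
  have hx0 : 0 ≤ x₀ := hx ▸ norm_nonneg x
  rw [← integral_indicator measurableSet_Ioi, (integral_linkLaw hra hh hx hx₀
    ((integrable_indicator_iff measurableSet_Ioi).2 hg)).2.2,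
    setIntegral_Ioo_indicator_Ioi hr.1 hr.2,
    intervalIntegral.integral_of_le (wMinus_le_wPlus hra hx0), integral_Ioc_eq_integral_Ioo]
  congr 1
  refine setIntegral_congr_fun measurableSet_Ioo fun u hu => ?_
  simp only [indicator_of_mem (show u ∈ Ioi r from hr.2.trans_lt hu.1)]

lemma setIntegral_Ioi_linkLaw_of_wMinus_le (hra : 0 < ra) (hh : 0 ≤ h) (hx : ‖x‖ = x₀)
    (hx₀ : x₀ ≤ ra) {r : ℝ} (hr : r ∈ Icc (wMinus ra h x₀) (wPlus ra h x₀)) {g : ℝ → ℝ}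
    (hg : IntegrableOn g (Ioi r) (linkLaw ra h x)) :
    ∫ u in Ioi r, g u ∂linkLaw ra h x = ∫ u in r..wPlus ra h x₀, g u * pdf₂ ra h x₀ u := by
  rw [← integral_indicator measurableSet_Ioi, (integral_linkLaw hra hh hx hx₀
    ((integrable_indicator_iff measurableSet_Ioi).2 hg)).2.2,
    setIntegral_Ioo_indicator_Ioi hr.1 hr.2, setIntegral_eq_zero_of_forall_eq_zero, zero_add]
  intro u hu
  rw [indicator_of_notMem (show u ∉ Ioi r from (hu.2.trans_le hr.1).not_gt), zero_mul]

lemma ae_linkLaw_gt (hra : 0 < ra) (hh : 0 ≤ h) (hx : ‖x‖ = x₀) (hx₀ : x₀ ≤ ra) :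
    ∀ᵐ u ∂linkLaw ra h x, h < u := by
  rw [linkLaw_eq hra hh hx hx₀, ae_add_measure_iff]
  exact ⟨(withDensity_absolutelyContinuous _ _).ae_le
      ((ae_restrict_mem measurableSet_Ioo).mono fun u hu => hu.1),
    (withDensity_absolutelyContinuous _ _).ae_le
      ((ae_restrict_mem measurableSet_Ioo).mono fun u hu => (le_wMinus).trans_lt hu.1)⟩

lemma nullSingletonClass_linkLaw (hra : 0 < ra) (hh : 0 ≤ h) (hx : ‖x‖ = x₀) (hx₀ : x₀ ≤ ra) :
    NullSingletonClass (linkLaw ra h x) := by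
  refine ⟨fun u => ?_⟩
  rw [linkLaw_eq hra hh hx hx₀, Measure.add_apply,
    withDensity_absolutelyContinuous _ _ (measure_singleton u),
    withDensity_absolutelyContinuous _ _ (measure_singleton u), add_zero]

lemma integral_pdf₁ (ra a b : ℝ) : ∫ u in a..b, pdf₁ ra u = (b ^ 2 - a ^ 2) / ra ^ 2 := by
  simp only [pdf₁, mul_div_assoc]
  rw [intervalIntegral.integral_const_mul, intervalIntegral.integral_div, integral_id]
  ring

/-- The mass beyond `w_m` is never computed: comparison with the case `r = h`, where the total is
`1`, eliminates it. -/
lemma linkLaw_real_Ioi_of_le_wMinus (hra : 0 < ra) (hh : 0 ≤ h) (hx : ‖x‖ = x₀) (hx₀ : x₀ ≤ ra)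
    {r : ℝ} (hr : r ∈ Icc h (wMinus ra h x₀)) :
    (linkLaw ra h x).real (Ioi r) = 1 - cdf₁ ra h r := by
  have : Fact (0 < ra) := ⟨hra⟩
  have key {r : ℝ} (hr : r ∈ Icc h (wMinus ra h x₀)) := setIntegral_Ioi_linkLaw_of_le_wMinus
    hra hh hx hx₀ hr (g := fun _ => 1) (integrable_const _)
  have h1 := key ⟨le_rfl, le_wMinus⟩
  have h2 := key hr
  have h3 : (linkLaw ra h x).real (Ioi h) = 1 := by
    have h4 : linkLaw ra h x (Ioi h) = 1 := by
      rw [← prob_compl_eq_zero_iff measurableSet_Ioi]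
      exact ae_iff.1 (ae_linkLaw_gt hra hh hx hx₀)
    simp [measureReal_def, h4]
  simp only [setIntegral_const, smul_eq_mul, mul_one, one_mul, integral_pdf₁, h3] at h1 h2
  rw [h2, cdf₁]
  linear_combination -h1

lemma sq_sub_sq_bounds {w : ℝ}
    (hw : w ∈ Ioo (wMinus ra h x₀) (wPlus ra h x₀)) :
    (ra - x₀) ^ 2 < w ^ 2 - h ^ 2 ∧ w ^ 2 - h ^ 2 < (ra + x₀) ^ 2 := by
  have hw0 : 0 < w := (sqrt_nonneg _).trans_lt hw.1
  have h1 := (sqrt_lt' hw0).1 hw.1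
  have h2 := (lt_sqrt hw0.le).1 hw.2
  constructor <;> linarith

/-- The derivative of a segment area `θ - sin (2 θ) / 2` in terms of the cosine `c` of `θ`. -/
lemma hasDerivAt_arccos_segment {c : ℝ → ℝ} {c' w : ℝ} (hc : HasDerivAt c c' w)
    (h1 : -1 < c w) (h2 : c w < 1) :
    HasDerivAt (fun w => arccos (c w) - 1 / 2 * sin (2 * arccos (c w)))
      (-2 * √(1 - c w ^ 2) * c') w := by
  have hθ := (hasDerivAt_arccos h1.ne' h2.ne).comp w hc
  have hs : 0 < √(1 - c w ^ 2) := sqrt_pos.2 (by nlinarith)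
  have hs2 : √(1 - c w ^ 2) ^ 2 = 1 - c w ^ 2 := sq_sqrt (by nlinarith)
  refine (hθ.sub (((hasDerivAt_sin _).comp w (hθ.const_mul 2)).const_mul (1 / 2))).congr_deriv ?_
  simp only [Function.comp]
  rw [cos_two_mul, cos_arccos h1.le h2.le]
  field_simp
  linear_combination 2 * c' * hs2

/-- `cdf₂` is the area of a lens, two circular segments on a common chord, divided by the disk area.
The terms from the moving angles cancel the `sin (2 θ*)` term, because both circles give the same
half-chord; `θ*` times the derivative of `ρ² / (π ra²)` remains. -/
lemma hasDerivAt_cdf₂ (hx₀ : x₀ ≤ ra) (hx1 : 0 < x₀) (hra : 0 < ra) {w : ℝ}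
    (hw : w ∈ Ioo (wMinus ra h x₀) (wPlus ra h x₀)) :
    HasDerivAt (cdf₂ ra h x₀) (pdf₂ ra h x₀ w) w := by
  obtain ⟨hlo, hhi⟩ := sq_sub_sq_bounds hw
  have hρ2 : 0 < w ^ 2 - h ^ 2 := (sq_nonneg _).trans_lt hlo
  set ρ := √(w ^ 2 - h ^ 2) with hρ
  have hρ0 : 0 < ρ := sqrt_pos.2 hρ2
  have hρsq : ρ ^ 2 = w ^ 2 - h ^ 2 := sq_sqrt hρ2.le
  have hd : edgeDist ra h ^ 2 = ra ^ 2 + h ^ 2 := sq_sqrt (by positivity)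
  have hρlo : ra - x₀ < ρ := lt_of_pow_lt_pow_left₀ 2 hρ0.le (by rwa [hρsq])
  have hρhi : ρ < ra + x₀ := lt_of_pow_lt_pow_left₀ 2 (by positivity) (by rwa [hρsq])
  have hsq : HasDerivAt (fun w : ℝ => w ^ 2) (2 * w) w := by simpa using hasDerivAt_pow 2 w
  have hρ' : HasDerivAt (fun w => √(w ^ 2 - h ^ 2)) (w / ρ) w := by
    refine ((hsq.sub_const (h ^ 2)).sqrt hρ2.ne').congr_deriv ?_
    rw [← hρ, mul_div_mul_left _ _ two_ne_zero]
  set c₁ : ℝ → ℝ := fun w => (w ^ 2 + x₀ ^ 2 - edgeDist ra h ^ 2) / (2 * x₀ * √(w ^ 2 - h ^ 2))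
    with hc₁
  set c₂ : ℝ → ℝ := fun w => (x₀ ^ 2 + edgeDist ra h ^ 2 - w ^ 2) / (2 * x₀ * ra) with hc₂
  have e₁ : c₁ w = (ρ ^ 2 + x₀ ^ 2 - ra ^ 2) / (2 * x₀ * ρ) := by
    simp only [hc₁, ← hρ, hd, hρsq]; ring_nf
  have e₂ : c₂ w = (x₀ ^ 2 + ra ^ 2 - ρ ^ 2) / (2 * x₀ * ra) := by
    simp only [hc₂, hd, hρsq]; ring_nf
  have hc₁' : HasDerivAt c₁ (w / (x₀ * ρ) - c₁ w * w / ρ ^ 2) w := by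
    refine (((hsq.add_const (x₀ ^ 2)).sub_const (edgeDist ra h ^ 2)).fun_div
      (hρ'.const_mul (2 * x₀)) (by positivity)).congr_deriv ?_
    simp only [hc₁, ← hρ]
    field_simp
  have hc₂' : HasDerivAt c₂ (-w / (x₀ * ra)) w := by
    refine ((hsq.const_sub (x₀ ^ 2 + edgeDist ra h ^ 2)).div_const (2 * x₀ * ra)).congr_deriv ?_
    field_simp
  -- The lengths `ρ`, `ra`, `x₀` form a nondegenerate triangle, so the cosines of its angles are
  -- strictly between `-1` and `1`.
  have b₁ : -1 < c₁ w ∧ c₁ w < 1 := by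
    rw [e₁, lt_div_iff₀ (by positivity), div_lt_one (by positivity)]
    constructor <;> nlinarith
  have b₂ : -1 < c₂ w ∧ c₂ w < 1 := by
    rw [e₂, lt_div_iff₀ (by positivity), div_lt_one (by positivity)]
    constructor <;> nlinarith
  -- Half the common chord, computed from each of the two centres.
  have hchord : ρ * √(1 - c₁ w ^ 2) = ra * √(1 - c₂ w ^ 2) := by
    rw [← sq_eq_sq₀ (by positivity) (by positivity), mul_pow, mul_pow,
      sq_sqrt (show 0 ≤ 1 - c₁ w ^ 2 by nlinarith), sq_sqrt (show 0 ≤ 1 - c₂ w ^ 2 by nlinarith),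
      e₁, e₂]
    field_simp
    ring
  have hθ := hasDerivAt_arccos_segment hc₁' b₁.1 b₁.2
  have hφ := hasDerivAt_arccos_segment hc₂' b₂.1 b₂.2
  have hmain := (((hsq.sub_const (h ^ 2)).div_const (π * ra ^ 2)).mul hθ).add
    (hφ.const_mul (1 / π))
  refine hmain.congr_deriv ?_
  have hsin : sin (2 * arccos (c₁ w)) = 2 * √(1 - c₁ w ^ 2) * c₁ w := by
    rw [sin_two_mul, sin_arccos, cos_arccos b₁.1.le b₁.2.le]
  have hp : pdf₂ ra h x₀ w = 2 * w / (π * ra ^ 2) * arccos (c₁ w) := rfl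
  rw [hsin, hp, ← hρsq]
  have := pi_pos
  generalize √(1 - c₁ w ^ 2) = S₁ at hchord ⊢
  generalize √(1 - c₂ w ^ 2) = S₂ at hchord ⊢
  field_simp
  linear_combination (-w) * hchord

lemma continuousOn_thetaStar (hx1 : 0 < x₀) {s : Set ℝ} (hs : ∀ w ∈ s, 0 < w ^ 2 - h ^ 2) :
    ContinuousOn (thetaStar ra h x₀) s := by
  unfold thetaStar
  refine continuous_arccos.comp_continuousOn (ContinuousOn.div (by fun_prop) (by fun_prop)
    fun w hw => ?_)
  have := sqrt_pos.2 (hs w hw)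
  positivity

lemma cdf₂_wPlus (hx1 : 0 < x₀) (hra : 0 < ra) : cdf₂ ra h x₀ (wPlus ra h x₀) = 1 := by
  have hw : wPlus ra h x₀ ^ 2 = (ra + x₀) ^ 2 + h ^ 2 := sq_sqrt (by positivity)
  have hd : edgeDist ra h ^ 2 = ra ^ 2 + h ^ 2 := sq_sqrt (by positivity)
  have hθ : thetaStar ra h x₀ (wPlus ra h x₀) = 0 := by
    rw [thetaStar, hw, hd, add_sub_cancel_right, sqrt_sq (by positivity), arccos_eq_zero,
      le_div_iff₀ (by positivity)]
    apply le_of_eq; ring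
  have hφ : phiStar ra h x₀ (wPlus ra h x₀) = π := by
    rw [phiStar, hw, hd, arccos_eq_pi, div_le_iff₀ (by positivity)]
    apply le_of_eq; ring
  rw [cdf₂, hθ, hφ]
  simp [pi_ne_zero]

/-- `cdf₂` is an antiderivative of `pdf₂` with value `1` at `w_p`. There the arccosines reach their
endpoints, so only continuity is used at `w_p`. -/
lemma linkLaw_real_Ioi_of_wMinus_lt (hra : 0 < ra) (hh : 0 ≤ h) (hx : ‖x‖ = x₀) (hx₀ : x₀ ≤ ra)
    {r : ℝ} (hr : r ∈ Ioo (wMinus ra h x₀) (wPlus ra h x₀)) :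
    (linkLaw ra h x).real (Ioi r) = 1 - cdf₂ ra h x₀ r := by
  have : Fact (0 < ra) := ⟨hra⟩
  have hx1 : 0 < x₀ := by
    refine (hx ▸ norm_nonneg x : 0 ≤ x₀).lt_of_ne' fun h0 => ?_
    have := hr.1.trans hr.2
    simp [wMinus, wPlus, h0] at this
  have h1 := setIntegral_Ioi_linkLaw_of_wMinus_le hra hh hx hx₀ (Ioo_subset_Icc_self hr)
    (g := fun _ => 1) (integrable_const _)
  simp only [setIntegral_const, smul_eq_mul, mul_one, one_mul] at h1
  have hpos : ∀ w ∈ Icc r (wPlus ra h x₀), 0 < w ^ 2 - h ^ 2 := fun w hw => by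
    have h2 := (sq_sub_sq_bounds hr).1
    have h3 : 0 < r := (sqrt_nonneg _).trans_lt hr.1
    nlinarith [hw.1, sq_nonneg (ra - x₀)]
  have hθ := continuousOn_thetaStar (ra := ra) hx1 hpos
  have hφ : Continuous (phiStar ra h x₀) := by
    unfold phiStar
    exact continuous_arccos.comp (by fun_prop)
  have hcdf : ContinuousOn (cdf₂ ra h x₀) (Icc r (wPlus ra h x₀)) := by
    unfold cdf₂
    have := continuous_sin.comp_continuousOn (hθ.const_mul 2)
    exact ContinuousOn.add (ContinuousOn.mul (by fun_prop) (hθ.sub (this.const_mul _)))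
      (by fun_prop)
  have hpdf : ContinuousOn (pdf₂ ra h x₀) (Icc r (wPlus ra h x₀)) := by
    have : ContinuousOn (fun w => 2 * w / (π * ra ^ 2)) (Icc r (wPlus ra h x₀)) := by fun_prop
    exact this.mul hθ
  rw [h1, intervalIntegral.integral_eq_sub_of_hasDerivAt_of_le hr.2.le hcdf
    (fun w hw => hasDerivAt_cdf₂ hx₀ hx1 hra ⟨hr.1.trans hw.1, hw.2⟩)
    (hpdf.intervalIntegrable_of_Icc hr.2.le), cdf₂_wPlus hx1 hra]

end Distribution

/-! ### The coverage probability -/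

section Coverage

open Real Set

variable {n m₀ : ℕ} {m α β ra h x₀ r s : ℝ} {x : EuclideanSpace ℝ (Fin 2)}

lemma integrableOn_laplaceKernel (μ : Measure ℝ) [IsProbabilityMeasure μ] (α : ℝ) (hm : 0 < m)
    (hr : 0 ≤ r) (hs : 0 ≤ s) :
    IntegrableOn (fun u => (1 + s * u ^ (-α) / m) ^ (-m)) (Ioi r) μ := by
  refine Integrable.of_bound (Measurable.aestronglyMeasurable (by fun_prop)) 1 ?_
  filter_upwards [ae_restrict_mem measurableSet_Ioi] with u hu
  have hu0 : 0 ≤ s * u ^ (-α) / m :=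
    div_nonneg (mul_nonneg hs (rpow_nonneg (hr.trans (le_of_lt hu)) _)) hm.le
  rw [norm_of_nonneg (rpow_nonneg (by linarith) _)]
  exact rpow_le_one_of_one_le_of_nonpos (by linarith) (by linarith)

lemma laplaceA_eq (hm : 0 < m) (hra : 0 < ra) (hh : 0 ≤ h) (hx : ‖x‖ = x₀) (hx₀ : x₀ ≤ ra)
    (hr : r ∈ Ioo h (wMinus ra h x₀)) (hs : 0 < s) :
    laplaceA ra h x₀ (n + 1) α m s r =
      ((∫ u in Ioi r, (1 + s * u ^ (-α) / m) ^ (-m) ∂linkLaw ra h x) /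
        (linkLaw ra h x).real (Ioi r)) ^ n := by
  have : Fact (0 < ra) := ⟨hra⟩
  rw [linkLaw_real_Ioi_of_le_wMinus hra hh hx hx₀ (Ioo_subset_Icc_self hr),
    setIntegral_Ioi_linkLaw_of_le_wMinus hra hh hx hx₀ (Ioo_subset_Icc_self hr)
      (integrableOn_laplaceKernel _ α hm (hh.trans hr.1.le) hs.le), laplaceA, add_div]
  simp only [← mul_div_assoc, intervalIntegral.integral_div, Nat.add_sub_cancel]

lemma laplaceB_eq (hm : 0 < m) (hra : 0 < ra) (hh : 0 ≤ h) (hx : ‖x‖ = x₀) (hx₀ : x₀ ≤ ra)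
    (hr : r ∈ Ioo (wMinus ra h x₀) (wPlus ra h x₀)) (hs : 0 < s) :
    laplaceB ra h x₀ (n + 1) α m s r =
      ((∫ u in Ioi r, (1 + s * u ^ (-α) / m) ^ (-m) ∂linkLaw ra h x) /
        (linkLaw ra h x).real (Ioi r)) ^ n := by
  have : Fact (0 < ra) := ⟨hra⟩
  rw [linkLaw_real_Ioi_of_wMinus_lt hra hh hx hx₀ hr,
    setIntegral_Ioi_linkLaw_of_wMinus_le hra hh hx hx₀ (Ioo_subset_Icc_self hr)
      (integrableOn_laplaceKernel _ α hm ((sqrt_nonneg _).trans hr.1.le) hs.le), laplaceB]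
  simp only [← mul_div_assoc, intervalIntegral.integral_div, Nat.add_sub_cancel]

/-- The factor `(1 - F₁) ^ n` is the mass already contained in `condCoverage`, so the conditional
transform becomes unconditional. -/
lemma coverageA_eq (hn : 1 ≤ n) (hm₀ : 1 ≤ m₀) (hm : 0 < m) (hβ : 0 < β) (hra : 0 < ra)
    (hh : 0 ≤ h) (hx : ‖x‖ = x₀) (hx₀ : x₀ ≤ ra) (hr : r ∈ Ioo h (wMinus ra h x₀)) :
    coverageA ra h x₀ (n + 1) m₀ α m β r =
      ((n + 1 : ℕ) * (condCoverage (linkLaw ra h x) (gammaMeasure m₀ m₀) (gammaMeasure m m)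
        n α β r).toReal) * pdf₁ ra r := by
  have : Fact (0 < ra) := ⟨hra⟩
  rw [← sum_iteratedDeriv_laplace (linkLaw ra h x) hn hm₀ hm (hh.trans_lt hr.1) hβ
    fun s hs => laplaceA_eq hm hra hh hx hx₀ hr hs,
    linkLaw_real_Ioi_of_le_wMinus hra hh hx hx₀ (Ioo_subset_Icc_self hr), coverageA,
    Nat.add_sub_cancel]
  ring

lemma coverageB_eq (hn : 1 ≤ n) (hm₀ : 1 ≤ m₀) (hm : 0 < m) (hβ : 0 < β) (hra : 0 < ra)
    (hh : 0 ≤ h) (hx : ‖x‖ = x₀) (hx₀ : x₀ ≤ ra)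
    (hr : r ∈ Ioo (wMinus ra h x₀) (wPlus ra h x₀)) :
    coverageB ra h x₀ (n + 1) m₀ α m β r =
      ((n + 1 : ℕ) * (condCoverage (linkLaw ra h x) (gammaMeasure m₀ m₀) (gammaMeasure m m)
        n α β r).toReal) * pdf₂ ra h x₀ r := by
  have : Fact (0 < ra) := ⟨hra⟩
  rw [← sum_iteratedDeriv_laplace (linkLaw ra h x) hn hm₀ hm
    ((sqrt_nonneg _).trans_lt hr.1) hβ fun s hs => laplaceB_eq hm hra hh hx hx₀ hr hs,
    linkLaw_real_Ioi_of_wMinus_lt hra hh hx hx₀ hr, coverageB, Nat.add_sub_cancel]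
  ring

/-- The joint law of link distances and gains. -/
lemma hasLaw_linkDist_gain {Ω : Type*} [MeasurableSpace Ω] {P : Measure Ω}
    [IsProbabilityMeasure P] {γ₀ γ : Measure ℝ} [IsProbabilityMeasure γ₀]
    [IsProbabilityMeasure γ] (h : ℝ) (x : EuclideanSpace ℝ (Fin 2)) (hra : 0 < ra)
    {Y : Fin (n + 1) → Ω → EuclideanSpace ℝ (Fin 2)}
    (hY : ∀ i, HasLaw (Y i) (volume[|Metric.closedBall 0 ra]) P) (hYi : iIndepFun Y P)
    {G : Fin (n + 1) → Ω → ℝ} (hG₀ : HasLaw (G 0) γ₀ P) (hG : ∀ i, i ≠ 0 → HasLaw (G i) γ P)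
    (hGi : iIndepFun G P) (hYG : IndepFun (fun ω i => Y i ω) (fun ω i => G i ω) P) :
    HasLaw (fun ω => (linkDist h x fun i => Y i ω, fun i => G i ω))
      ((Measure.pi fun _ => linkLaw ra h x).prod
        (Measure.pi (Fin.cons (α := fun _ => Measure ℝ) γ₀ fun _ : Fin n => γ))) P := by
  have : Fact (0 < ra) := ⟨hra⟩
  have hmeas := measurable_dist_atHeight h x
  have hW (i : Fin (n + 1)) : HasLaw (fun ω => dist (atHeight 0 x) (atHeight h (Y i ω)))
      (linkLaw ra h x) P :=
    HasLaw.fun_comp (Y := fun y => dist (atHeight 0 x) (atHeight h y))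
      ⟨hmeas.aemeasurable, rfl⟩ (hY i)
  have hWlaw := (hYi.comp (fun _ y => dist (atHeight 0 x) (atHeight h y)) fun _ => hmeas).hasLaw_pi
    hW
  have hG' (i : Fin (n + 1)) :
      HasLaw (G i) (Fin.cons (α := fun _ => Measure ℝ) γ₀ (fun _ : Fin n => γ) i) P := by
    refine Fin.cases hG₀ (fun k => ?_) i
    rw [Fin.cons_succ]
    exact hG _ (Fin.succ_ne_zero k)
  have hlink : Measurable (linkDist (N := n + 1) h x) :=
    measurable_pi_lambda _ fun i => hmeas.comp (measurable_pi_apply i)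
  exact IndepFun.hasLaw_prod hWlaw (hGi.hasLaw_pi hG') (hYG.comp hlink measurable_id)

end Coverage

end UAV
end

open UAV

theorem theorem1 {Ω : Type*} [MeasurableSpace Ω] (P : Measure Ω) [IsProbabilityMeasure P]
    (N : ℕ) [NeZero N] (hN : 2 ≤ N)
    (m₀ : ℕ) (hm₀ : 1 ≤ m₀) (m : ℝ) (hm : 0 < m)
    (α : ℝ) (hα : 2 < α) (β : ℝ) (hβ : 0 < β)
    (ra : ℝ) (hra : 0 < ra) (h : ℝ) (hh : 0 ≤ h)
    (x : EuclideanSpace ℝ (Fin 2)) (x₀ : ℝ) (hx : ‖x‖ = x₀) (hx₀ : x₀ ≤ ra)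
    -- the transmitters: independent and uniform in the disk of radius `ra` at height `h`
    (Y : Fin N → Ω → EuclideanSpace ℝ (Fin 2))
    (hY : ∀ i, HasLaw (Y i) (volume[|Metric.closedBall 0 ra]) P)
    (hYi : iIndepFun Y P)
    -- the channel gains: `G 0` of the serving link, `G i` with `i ≠ 0` of the interfering links
    (G : Fin N → Ω → ℝ)
    (hG₀ : HasLaw (G 0) (gammaMeasure m₀ m₀) P)
    (hG : ∀ i, i ≠ 0 → HasLaw (G i) (gammaMeasure m m) P)
    (hGi : iIndepFun G P)
    (hYG : IndepFun (fun ω i => Y i ω) (fun ω i => G i ω) P) :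
    -- the derivatives and the integrals in the formula exist
    (∀ r ∈ Set.Ioo h (UAV.wMinus ra h x₀),
      ContDiffAt ℝ m₀ (fun s => UAV.laplaceA ra h x₀ N α m s r) (m₀ * β * r ^ α)) ∧
    (∀ r ∈ Set.Ioo (UAV.wMinus ra h x₀) (UAV.wPlus ra h x₀),
      ContDiffAt ℝ m₀ (fun s => UAV.laplaceB ra h x₀ N α m s r) (m₀ * β * r ^ α)) ∧
    IntervalIntegrable (UAV.coverageA ra h x₀ N m₀ α m β) volume h (UAV.wMinus ra h x₀) ∧
    IntervalIntegrable (UAV.coverageB ra h x₀ N m₀ α m β) volume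
      (UAV.wMinus ra h x₀) (UAV.wPlus ra h x₀) ∧
    P.real {ω | β < UAV.SIR α (UAV.linkDist h x fun i => Y i ω) (fun i => G i ω)} =
      (∫ r in h..UAV.wMinus ra h x₀, UAV.coverageA ra h x₀ N m₀ α m β r) +
        ∫ r in UAV.wMinus ra h x₀..UAV.wPlus ra h x₀, UAV.coverageB ra h x₀ N m₀ α m β r := by
  obtain ⟨n, rfl⟩ : ∃ n, N = n + 1 := ⟨N - 1, by omega⟩
  have hn : 1 ≤ n := by omega
  have hx0 : 0 ≤ x₀ := hx ▸ norm_nonneg x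
  have hm₀' : (0 : ℝ) < m₀ := by exact_mod_cast hm₀
  have : Fact (0 < ra) := ⟨hra⟩
  have := isProbabilityMeasure_gammaMeasure hm hm
  have := isProbabilityMeasure_gammaMeasure hm₀' hm₀'
  have := nullSingletonClass_linkLaw hra hh hx hx₀
  have hs {r : ℝ} (hr : 0 < r) : 0 < m₀ * β * r ^ α :=
    mul_pos (mul_pos hm₀' hβ) (Real.rpow_pos_of_pos hr α)
  set T : ℝ → ENNReal :=
    condCoverage (linkLaw ra h x) (gammaMeasure m₀ m₀) (gammaMeasure m m) n α β with hT
  have hTm : Measurable T := measurable_condCoverage _ _ _ α β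
  have hT1 (r : ℝ) : T r ≤ 1 := condCoverage_le_one _ _ _ α β r
  have hTint : Integrable (fun r => ((n + 1 : ℕ) : ℝ) * (T r).toReal) (linkLaw ra h x) := by
    refine (Integrable.of_bound hTm.ennreal_toReal.aestronglyMeasurable 1
      (ae_of_all _ fun r => ?_)).const_mul _
    rw [Real.norm_of_nonneg ENNReal.toReal_nonneg]
    exact ENNReal.toReal_le_of_le_ofReal one_pos.le (by simpa using hT1 r)
  -- Integrability of both integrands and the splitting of the integral come together from the
  -- two-piece density.
  obtain ⟨hA, hB, hAB⟩ := integral_linkLaw hra hh hx hx₀ hTint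
  -- The identities are needed only on open intervals, since the endpoints are null; this avoids the
  -- degenerate values there.
  have hcA : Set.EqOn (fun r => ((n + 1 : ℕ) : ℝ) * (T r).toReal * pdf₁ ra r)
      (coverageA ra h x₀ (n + 1) m₀ α m β) (Set.Ioo h (wMinus ra h x₀)) :=
    fun r hr => (coverageA_eq hn hm₀ hm hβ hra hh hx hx₀ hr).symm
  have hcB : Set.EqOn (fun r => ((n + 1 : ℕ) : ℝ) * (T r).toReal * pdf₂ ra h x₀ r)
      (coverageB ra h x₀ (n + 1) m₀ α m β) (Set.Ioo (wMinus ra h x₀) (wPlus ra h x₀)) :=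
    fun r hr => (coverageB_eq hn hm₀ hm hβ hra hh hx hx₀ hr).symm
  refine ⟨fun r hr => contDiffAt_of_eq_laplace (linkLaw ra h x) hm (hh.trans_lt hr.1)
      (fun s hs => laplaceA_eq hm hra hh hx hx₀ hr hs) (hs (hh.trans_lt hr.1)) m₀,
    fun r hr => contDiffAt_of_eq_laplace (linkLaw ra h x) hm ((Real.sqrt_nonneg _).trans_lt hr.1)
      (fun s hs => laplaceB_eq hm hra hh hx hx₀ hr hs)
      (hs ((Real.sqrt_nonneg _).trans_lt hr.1)) m₀, ?_, ?_, ?_⟩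
  · rw [intervalIntegrable_iff_integrableOn_Ioo_of_le le_wMinus]
    exact (integrableOn_congr_fun hcA measurableSet_Ioo).1 hA
  · rw [intervalIntegrable_iff_integrableOn_Ioo_of_le (wMinus_le_wPlus hra hx0)]
    exact (integrableOn_congr_fun hcB measurableSet_Ioo).1 hB
  · have hlaw := hasLaw_linkDist_gain h x hra hY hYi hG₀ hG hGi hYG
    have hP := hlaw.measureReal_eq (p := fun q => β < SIR α q.1 q.2)
      (measurableSet_lt measurable_const (measurable_SIR α))
    rw [intervalIntegral.integral_of_le le_wMinus, integral_Ioc_eq_integral_Ioo,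
      intervalIntegral.integral_of_le (wMinus_le_wPlus hra hx0), integral_Ioc_eq_integral_Ioo,
      ← setIntegral_congr_fun measurableSet_Ioo hcA, ← setIntegral_congr_fun measurableSet_Ioo hcB,
      ← hAB, integral_const_mul, integral_toReal hTm.aemeasurable
        (ae_of_all _ fun r => (hT1 r).trans_lt ENNReal.one_lt_top)]
    refine hP.trans ?_
    rw [measureReal_def, measure_SIR_gt, ENNReal.toReal_mul]
    congr 1
    exact_mod_cast ENNReal.toReal_natCast (n + 1)
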